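/- There is an absolute constant $c>0$ such that the following holds. Let $q$ be a natural number and $\mathcal S_1,\dots,\mathcal S_L$ subspaces of $\mathbb R^m$ of dimensions $d_1,\dots,d_L\ge 1$, where $\mathcal S_l$ is the column space of a (deterministic) matrix $U^{(l)}\in\mathbb R^{m\times d_l}$ with orthonormal columns. Let $\sigma\ge 0$ and $n_l=\rho_l q\in\mathbb N$ with real $\rho_l\ge 6$, $l\in[L]$, and let $N=\sum_l n_l$ and $d_{\max}=\max_l d_l$. Consider the $N$ random points $x^{(l)}_j=U^{(l)}a^{(l)}_j+e^{(l)}_j$, $l\in[L]$, $j\in[n_l]$, where each $a^{(l)}_j$ is uniformly distributed on the unit sphere of $\mathbb R^{d_l}$, each $e^{(l)}_j$ has distribution $\mathcal N(0,(\sigma^2/m)I)$ on $\mathbb R^m$, and all the $a^{(l)}_j$ and $e^{(l)}_j$ are independent. Put $\mathrm{aff}(\mathcal S_k,\mathcal S_l)=\frac{1}{\sqrt{\min(d_k,d_l)}}\,\|(U^{(k)})^{T}U^{(l)}\|_F$ and suppose that $$\max_{k\ne l}\mathrm{aff}(\mathcal S_k,\mathcal S_l)+\frac{\sigma(1+\sigma)}{\sqrt{\log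 N}}\,\frac{\sqrt{d_{\max}}}{\sqrt m}\le\frac{1}{12\log N}\qquad\text{and}\qquad m\ge 6\log N$$ (the maximum is $0$ if $L\le 1$). Enumerate the points as $x_1,\dots,x_N$. The thresholding-based subspace clustering (TSC) algorithm with parameter $q$ chooses for each $j$ a set $S_j\subset[N]\setminus\{j\}$ of cardinality $q$ such that $|\langle x_j,x_i\rangle|\ge|\langle x_j,x_p\rangle|$ for all $i\in S_j$ and all $p\in[N]\setminus(S_j\cup\{j\})$. It lets $z_j\in\mathbb R^N$ have $i$th entry $|\langle x_j,x_i\rangle|$ if $i\in S_j$ and $0$ otherwise, and forms the adjacency matrix $A_{ij}=|[z_j]_i|+|[z_i]_j|$. Then, with probability at least $$1-\frac{10}{N}-\sum_{l=1}^{L}n_l\,e^{-c(n_l-1)},$$ for every choice of such sets $S_j$ (that is, however ties are broken) the subspace detection property holds: $A_{ij}\ne 0$ only if $x_i$ and $x_j$ were drawn from the same subspace $\mathcal S_l$, and for every $i\in[N]$ there are at least $q$ indices $j$ with $A_{ij}\neq 0$ such that $x_j$ was drawn from the same subspace as $x_i$. -/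

import Mathlib

open MeasureTheory ProbabilityTheory

namespace TSC

/-- The uniform probability distribution on the unit sphere of `ℝᵈ` (normalised surface measure),
seen as a measure on `ℝᵈ`. -/
noncomputable def uniformSphere (d : ℕ) : Measure (EuclideanSpace ℝ (Fin d)) :=
  Measure.map Subtype.val
    (((volume : Measure (EuclideanSpace ℝ (Fin d))).toSphere Set.univ)⁻¹ •
      (volume : Measure (EuclideanSpace ℝ (Fin d))).toSphere)

/-- The Gaussian distribution `N(0, (σ²/m) I)` on `ℝᵐ`. -/
noncomputable def noiseLaw (m : ℕ) (σ : ℝ) : Measure (EuclideanSpace ℝ (Fin m)) :=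
  multivariateGaussian 0 ((σ ^ 2 / (m : ℝ)) • (1 : Matrix (Fin m) (Fin m) ℝ))

/-- The affinity `‖Uᵀ V‖_F / √(min d d')` of the column spaces of two matrices `U`, `V` with
orthonormal columns. -/
noncomputable def affinity {m d d' : ℕ} (U : Matrix (Fin m) (Fin d) ℝ)
    (V : Matrix (Fin m) (Fin d') ℝ) : ℝ :=
  1 / Real.sqrt ((min d d' : ℕ) : ℝ) *
    Real.sqrt (∑ i, ∑ j, (U.transpose * V) i j ^ 2)

/-- The largest affinity between two different subspaces of the family (`0` if there is at most
one subspace). -/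
noncomputable def maxAffinity {L m : ℕ} {d : Fin L → ℕ}
    (U : (l : Fin L) → Matrix (Fin m) (Fin (d l)) ℝ) : ℝ :=
  ⨆ p : {p : Fin L × Fin L // p.1 ≠ p.2}, affinity (U p.1.1) (U p.1.2)

/-- `T` is an admissible outcome of the selection step of TSC for the point `x j`: it consists of
`q` indices other than `j` whose points have the largest absolute inner products with `x j`
(ties may be broken in any way). -/
def IsNeighborSet {ι : Type*} {m : ℕ} (q : ℕ) (x : ι → EuclideanSpace ℝ (Fin m)) (j : ι)
    (T : Finset ι) : Prop :=
  T.card = q ∧ j ∉ T ∧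
    ∀ i ∈ T, ∀ p, p ≠ j → p ∉ T → |inner ℝ (x j) (x p)| ≤ |inner ℝ (x j) (x i)|

/-- The vector `z_j` with `i`th entry `|⟨x_j, x_i⟩|` if `i ∈ T` and `0` otherwise. -/
noncomputable def coeffVec {ι : Type*} [DecidableEq ι] {m : ℕ} (x : ι → EuclideanSpace ℝ (Fin m))
    (j : ι) (T : Finset ι) : ι → ℝ :=
  fun i => if i ∈ T then |inner ℝ (x j) (x i)| else 0

/-- The TSC adjacency matrix `A_ij = |[z_j]_i| + |[z_i]_j|` built from the selected sets `S j`. -/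
noncomputable def adjacency {ι : Type*} [DecidableEq ι] {m : ℕ}
    (x : ι → EuclideanSpace ℝ (Fin m)) (S : ι → Finset ι) : Matrix ι ι ℝ :=
  fun i j => |coeffVec x j (S j) i| + |coeffVec x i (S i) j|

/-- The subspace detection property of an adjacency matrix `A` with parameter `q`, where
`label i` is the cluster of the `i`th point: there are no connections between different clusters,
and every point is connected to at least `q` points of its own cluster. -/
def SubspaceDetection {ι κ : Type*} (q : ℕ) (label : ι → κ) (A : Matrix ι ι ℝ) : Prop :=
  (∀ i j, A i j ≠ 0 → label i = label j) ∧
    ∀ i, q ≤ Nat.card {j : ι // label j = label i ∧ A i j ≠ 0}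

end TSC

namespace TSC

open scoped ENNReal

/-! Detection follows once, for every point, a threshold `τ i` separates the two kinds of inner
products: all points of other clusters lie strictly below it and at least `q` points lie at or above
it. Any `q` nearest neighbours then lie above the threshold, hence in the right cluster
(`subspaceDetection_of_separated`). Write `l = log N`, `η = σ √(l/m)`, `ξ = σ² √(l/m)`; the
threshold is `5/12 * (1 - 2η) / √dᵢ`.

Between clusters, `⟨xᵢ, xₚ⟩` splits into a signal, a mixed and a noise part. The signal part is a
bilinear form in two independent uniform points of spheres, with scale `‖Uₚᵀ Uᵢ‖_F / √(dₚ dᵢ)` and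
exponential tails (`uniformSphere_prod_bilinear_le`). The mixed part is Gaussian given the signals,
and the noise part is Gaussian given one of the noises (`noiseLaw_prod_inner_add_inner_le`,
`noiseLaw_prod_inner_le`). Each pair fails with probability at most `20/3 * N⁻³`, and the clustering
condition puts the sum of the three bounds below the threshold (`separation`).

Inside a cluster, fix `xᵢ`. The inner product with another point is a sphere term plus an
independent centred Gaussian, and its fourth moment is at most three times the square of its second.
A moment inequality then makes it at least `5/12 * ‖Uᵀxᵢ‖ / √d` with probability at least `1/4`. As
the other points are independent, a Chernoff bound leaves fewer than a fifth of them that large with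
probability at most `exp(-(n-1)/1000)` (`measure_card_filter_lt_le`), and `n ≥ 6q` makes a fifth
enough. Also `‖Uᵀxᵢ‖ ≥ 1 - 2η` outside an event of probability `N⁻²`.

All facts about the sphere come from the standard Gaussian, written as a random radius times an
independent uniform direction, with Jensen's inequality in the radius. -/

/-! ### Product measures and the density of a Gaussian vector -/

theorem lintegral_pi_prod_eq_prod {ι : Type*} [Fintype ι] {E : ι → Type*}
    {mE : ∀ i, MeasurableSpace (E i)} (μ : (i : ι) → Measure (E i))
    [∀ i, IsProbabilityMeasure (μ i)]
    (f : (i : ι) → E i → ℝ≥0∞) (hf : ∀ i, Measurable (f i)) :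
    ∫⁻ x : (i : ι) → E i, ∏ i, f i (x i) ∂(Measure.pi μ) = ∏ i, ∫⁻ x, f i x ∂(μ i) := by
  rw [lintegral_prod_eq_prod_lintegral_of_indepFun Finset.univ
    (fun i (x : (i : ι) → E i) => f i (x i)) (iIndepFun_pi fun i => (hf i).aemeasurable)
    fun i => (hf i).comp (measurable_pi_apply i)]
  exact Finset.prod_congr rfl fun i _ => (measurePreserving_eval μ i).lintegral_comp (hf i)

theorem pi_gaussianReal_eq_withDensity (ι : Type*) [Fintype ι] :
    Measure.pi (fun _ : ι => gaussianReal 0 1) =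
      (volume : Measure (ι → ℝ)).withDensity (fun x => ∏ i, gaussianPDF 0 1 (x i)) := by
  refine Measure.pi_eq fun s hs => ?_
  rw [withDensity_apply _ (MeasurableSet.univ_pi hs), ← lintegral_indicator
    (MeasurableSet.univ_pi hs)]
  have h : ∀ x : ι → ℝ, (Set.univ.pi s).indicator (fun x => ∏ i, gaussianPDF 0 1 (x i)) x =
      ENNReal.ofReal (∏ i, (s i).indicator (gaussianPDFReal 0 1) (x i)) := by
    intro x
    by_cases hx : x ∈ Set.univ.pi s
    · rw [Set.indicator_of_mem hx, ENNReal.ofReal_prod_of_nonneg fun i _ =>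
        Set.indicator_nonneg (fun _ _ => gaussianPDFReal_nonneg _ _ _) _]
      exact Finset.prod_congr rfl fun i _ => by rw [Set.indicator_of_mem (hx i trivial)]; rfl
    · rw [Set.indicator_of_notMem hx]
      simp only [Set.mem_pi, Set.mem_univ, true_implies, not_forall] at hx
      obtain ⟨i, hi⟩ := hx
      rw [Finset.prod_eq_zero (Finset.mem_univ i) (Set.indicator_of_notMem hi _)]
      simp
  have hint : ∀ i, Integrable ((s i).indicator (gaussianPDFReal 0 1)) :=
    fun i => (integrable_gaussianPDFReal 0 1).indicator (hs i)
  simp_rw [h]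
  rw [← ofReal_integral_eq_lintegral_ofReal, integral_fintype_prod_volume_eq_prod
    (fun i => (s i).indicator (gaussianPDFReal 0 1)), ENNReal.ofReal_prod_of_nonneg]
  · refine Finset.prod_congr rfl fun i _ => ?_
    rw [integral_indicator (hs i), gaussianReal_apply_eq_integral _ one_ne_zero]
  · exact fun i _ => integral_nonneg fun x =>
      Set.indicator_nonneg (fun _ _ => gaussianPDFReal_nonneg _ _ _) _
  · exact Integrable.fintype_prod hint
  · exact Filter.Eventually.of_forall fun x => Finset.prod_nonneg fun i _ =>
      Set.indicator_nonneg (fun _ _ => gaussianPDFReal_nonneg _ _ _) _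

/-! ### The standard Gaussian in polar coordinates -/

/-- Only the dependence on the norm matters: it lets the density separate in polar coordinates. -/
theorem stdGaussian_eq_withDensity (d : ℕ) :
    ∃ h : ℝ → ℝ≥0∞, Measurable h ∧ stdGaussian (EuclideanSpace ℝ (Fin d)) =
      (volume : Measure (EuclideanSpace ℝ (Fin d))).withDensity (fun x => h ‖x‖) := by
  refine ⟨fun r => ENNReal.ofReal (((Real.sqrt (2 * Real.pi * (1 : NNReal)))⁻¹) ^ d *
    Real.exp (-r ^ 2 / 2)), by fun_prop, ?_⟩
  have hden : ∀ x : Fin d → ℝ, ∏ i, gaussianPDF 0 1 (x i) =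
      ENNReal.ofReal (((Real.sqrt (2 * Real.pi * (1 : NNReal)))⁻¹) ^ d *
        Real.exp (-‖(WithLp.toLp 2 x : EuclideanSpace ℝ (Fin d))‖ ^ 2 / 2)) := by
    intro x
    simp only [gaussianPDF]
    rw [← ENNReal.ofReal_prod_of_nonneg fun i _ => gaussianPDFReal_nonneg _ _ _]
    simp only [gaussianPDFReal, Finset.prod_mul_distrib, Finset.prod_const, Finset.card_univ,
      Fintype.card_fin]
    rw [← Real.exp_sum, EuclideanSpace.real_norm_sq_eq]
    simp [Finset.sum_div, neg_div]
  ext s hs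
  have hm := PiLp.volume_preserving_toLp (Fin d)
  rw [← map_pi_eq_stdGaussian, Measure.map_apply hm.measurable hs,
    pi_gaussianReal_eq_withDensity,
    withDensity_apply _ (hm.measurable hs), withDensity_apply _ hs]
  simp_rw [hden]
  exact hm.setLIntegral_comp_preimage hs (f := fun x : EuclideanSpace ℝ (Fin d) =>
    ENNReal.ofReal (((Real.sqrt (2 * Real.pi * (1 : NNReal)))⁻¹) ^ d *
        Real.exp (-‖x‖ ^ 2 / 2))) (by fun_prop)

theorem isProbabilityMeasure_uniformSphere {d : ℕ} (hd : 1 ≤ d) :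
    IsProbabilityMeasure (uniformSphere d) := by
  have : Nonempty (Fin d) := ⟨⟨0, hd⟩⟩
  constructor
  rw [uniformSphere, Measure.map_apply measurable_subtype_coe MeasurableSet.univ]
  simp only [Set.preimage_univ, Measure.smul_apply, smul_eq_mul]
  exact ENNReal.inv_mul_cancel (Measure.measure_univ_ne_zero.2 (Measure.toSphere_ne_zero _))
    (measure_ne_top _ _)

theorem norm_eq_one_ae_uniformSphere (d : ℕ) : ∀ᵐ x ∂(uniformSphere d), ‖x‖ = 1 := by
  rw [uniformSphere, ae_map_iff measurable_subtype_coe.aemeasurable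
    (measurableSet_eq_fun (by fun_prop) (by fun_prop))]
  exact Filter.Eventually.of_forall fun x => by simp

/-- The standard Gaussian is the law of the product of a random radius and an independent
uniformly distributed point of the sphere. -/
theorem exists_radial_law {d : ℕ} (hd : 1 ≤ d) :
    ∃ ρ : Measure ℝ, IsProbabilityMeasure ρ ∧
      ∀ f : EuclideanSpace ℝ (Fin d) → ℝ≥0∞, Measurable f →
        ∫⁻ x, f x ∂(stdGaussian (EuclideanSpace ℝ (Fin d))) =
          ∫⁻ a, ∫⁻ r, f (r • a) ∂ρ ∂(uniformSphere d) := by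
  have : Nonempty (Fin d) := ⟨⟨0, hd⟩⟩
  obtain ⟨h, hh, hG⟩ := stdGaussian_eq_withDensity d
  set E := EuclideanSpace ℝ (Fin d)
  set ν : Measure E := volume
  set T := ν.toSphere Set.univ
  have hT0 : T ≠ 0 := Measure.measure_univ_ne_zero.2 (Measure.toSphere_ne_zero _)
  have hT : T ≠ ∞ := measure_ne_top _ _
  set κ := Measure.volumeIoiPow (Module.finrank ℝ E - 1)
  -- The factor `T`, the total surface mass, cancels the normalisation in `uniformSphere`.
  set ρ : Measure ℝ := T • (κ.withDensity (fun r => h r)).map Subtype.val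
  have hρ : ∀ g : ℝ → ℝ≥0∞, Measurable g → ∫⁻ r, g r ∂ρ = T * ∫⁻ r, h r * g r ∂κ := by
    intro g hg
    rw [lintegral_smul_measure, lintegral_map hg measurable_subtype_coe,
      lintegral_withDensity_eq_lintegral_mul κ (f := fun r : Set.Ioi (0 : ℝ) => h r)
        (hh.comp measurable_subtype_coe) (g := fun r : Set.Ioi (0 : ℝ) => g r)
        (hg.comp measurable_subtype_coe)]
    simp
  have key : ∀ f : E → ℝ≥0∞, Measurable f →
      ∫⁻ x, f x ∂(stdGaussian E) = ∫⁻ a, ∫⁻ r, f (r • a) ∂ρ ∂(uniformSphere d) := by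
    intro f hf
    have hf2 : Measurable fun p : E × ℝ => h p.2 * f (p.2 • p.1) := by fun_prop
    have h1 : ∫⁻ x, f x ∂(stdGaussian E) =
        ∫⁻ p, h p.2 * f ((p.2 : ℝ) • (p.1 : E)) ∂(ν.toSphere.prod κ) := by
      rw [hG, lintegral_withDensity_eq_lintegral_mul _ (by fun_prop) hf]
      have hr : ∀ g : E → ℝ≥0∞, ∫⁻ x, g x ∂ν = ∫⁻ x : ({0}ᶜ : Set E), g x ∂(ν.comap (↑)) := by
        intro g
        rw [lintegral_subtype_comap (measurableSet_singleton _).compl, restrict_compl_singleton]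
      rw [hr]
      rw [← ν.measurePreserving_homeomorphUnitSphereProd.lintegral_comp
        (f := fun p : Metric.sphere (0 : E) 1 × Set.Ioi (0 : ℝ) =>
          h p.2 * f ((p.2 : ℝ) • (p.1 : E))) ?_]
      · refine lintegral_congr fun x => ?_
        have hx : ‖(x : E)‖ ≠ 0 := norm_ne_zero_iff.2 x.2
        simp [smul_smul, hx]
      · exact hf2.comp ((measurable_subtype_coe.comp measurable_fst).prodMk
          (measurable_subtype_coe.comp measurable_snd))
    have h3 : Measurable fun p : E × ℝ => f (p.2 • p.1) := by fun_prop
    rw [h1, lintegral_prod (fun p : Metric.sphere (0 : E) 1 × Set.Ioi (0 : ℝ) =>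
          h p.2 * f ((p.2 : ℝ) • (p.1 : E))) (hf2.comp ((measurable_subtype_coe.comp measurable_fst).prodMk
          (measurable_subtype_coe.comp measurable_snd))).aemeasurable]
    have hsf : SFinite ρ := inferInstance
    rw [uniformSphere, lintegral_map h3.lintegral_prod_right' measurable_subtype_coe,
      lintegral_smul_measure]
    have h2 : ∀ a : Metric.sphere (0 : E) 1, ∫⁻ r, f (r • (a : E)) ∂ρ =
        T * ∫⁻ r, h r * f ((r : ℝ) • (a : E)) ∂κ := fun a => hρ _ (by fun_prop)
    simp_rw [h2]
    rw [lintegral_const_mul' _ _ hT, smul_eq_mul, ← mul_assoc, ENNReal.inv_mul_cancel hT0 hT,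
      one_mul]
  refine ⟨ρ, ⟨?_⟩, key⟩
  have := isProbabilityMeasure_uniformSphere hd
  -- Testing the disintegration with the constant 1 gives the total mass of `ρ`, so no radial
  -- integral is evaluated.
  have h1 := key (fun _ => 1) measurable_const
  simpa using h1.symm

theorem map_inner_stdGaussian {d : ℕ} (u : EuclideanSpace ℝ (Fin d)) :
    (stdGaussian (EuclideanSpace ℝ (Fin d))).map (fun x => inner ℝ x u) =
      gaussianReal 0 (‖u‖₊ ^ 2) := by
  have h : (fun x : EuclideanSpace ℝ (Fin d) => inner ℝ x u) = innerSL ℝ u := by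
    ext x; simp [real_inner_comm]
  rw [h, IsGaussian.map_eq_gaussianReal, integral_strongDual_stdGaussian,
    variance_dual_stdGaussian]
  congr 1
  rw [innerSL_apply_norm]
  ext; simp

/-! ### Moments of one-dimensional Gaussians -/

theorem integral_pow_gaussianReal (v : NNReal) (n : ℕ) :
    ∫ x, x ^ n ∂(gaussianReal 0 v) =
      iteratedDeriv n (fun t : ℝ => Real.exp (v * t ^ 2 / 2)) 0 := by
  have h := iteratedDeriv_mgf_zero (X := id) (μ := gaussianReal 0 v)
    (by simp [integrableExpSet_id_gaussianReal]) n
  rw [mgf_id_gaussianReal] at h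
  simpa using h.symm

theorem gaussianReal_moments (v : NNReal) :
    ∫ x, x ∂(gaussianReal 0 v) = 0 ∧ ∫ x, x ^ 2 ∂(gaussianReal 0 v) = (v : ℝ) ∧
      ∫ x, x ^ 3 ∂(gaussianReal 0 v) = 0 ∧ ∫ x, x ^ 4 ∂(gaussianReal 0 v) = 3 * (v : ℝ) ^ 2 := by
  set w : ℝ := (v : ℝ)
  have h0 : ∀ t : ℝ, HasDerivAt (fun t : ℝ => Real.exp (w * t ^ 2 / 2))
      (w * t * Real.exp (w * t ^ 2 / 2)) t := by
    intro t
    convert! ((((hasDerivAt_id t).pow 2).const_mul w).div_const 2).exp using 1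
    simp; ring
  have d1 : deriv (fun t : ℝ => Real.exp (w * t ^ 2 / 2)) =
      fun t => w * t * Real.exp (w * t ^ 2 / 2) := funext fun t => (h0 t).deriv
  have d2 : deriv (fun t : ℝ => w * t * Real.exp (w * t ^ 2 / 2)) =
      fun t => (w + w ^ 2 * t ^ 2) * Real.exp (w * t ^ 2 / 2) := by
    funext t
    refine (((hasDerivAt_id t).const_mul w).mul (h0 t)).deriv.trans ?_
    simp; ring
  have d3 : deriv (fun t : ℝ => (w + w ^ 2 * t ^ 2) * Real.exp (w * t ^ 2 / 2)) =
      fun t => (3 * w ^ 2 * t + w ^ 3 * t ^ 3) * Real.exp (w * t ^ 2 / 2) := by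
    funext t
    refine (((((hasDerivAt_id t).pow 2).const_mul (w ^ 2)).const_add w).mul (h0 t)).deriv.trans ?_
    simp; ring
  have d4 : deriv (fun t : ℝ => (3 * w ^ 2 * t + w ^ 3 * t ^ 3) * Real.exp (w * t ^ 2 / 2)) =
      fun t => (3 * w ^ 2 + 6 * w ^ 3 * t ^ 2 + w ^ 4 * t ^ 4) * Real.exp (w * t ^ 2 / 2) := by
    funext t
    refine ((((hasDerivAt_id t).const_mul (3 * w ^ 2)).add
      (((hasDerivAt_id t).pow 3).const_mul (w ^ 3))).mul (h0 t)).deriv.trans ?_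
    simp; ring
  refine ⟨integral_id_gaussianReal, ?_, ?_, ?_⟩
  all_goals
    rw [integral_pow_gaussianReal]
    simp only [iteratedDeriv_succ, iteratedDeriv_zero]
    rw [d1, d2]
  · simp [w]
  · rw [d3]; simp
  · rw [d3, d4]; simp [w]

theorem lintegral_exp_sq_gaussianReal {s : ℝ} (hs : s < 1 / 2) :
    ∫⁻ x, ENNReal.ofReal (Real.exp (s * x ^ 2)) ∂(gaussianReal 0 1) =
      ENNReal.ofReal ((Real.sqrt (1 - 2 * s))⁻¹) := by
  rw [gaussianReal_of_var_ne_zero 0 one_ne_zero, lintegral_withDensity_eq_lintegral_mul _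
    (measurable_gaussianPDF 0 1) (by fun_prop)]
  have hb : 0 < 1 / 2 - s := by linarith
  have h : ∀ x : ℝ, (gaussianPDF 0 1 * fun x => ENNReal.ofReal (Real.exp (s * x ^ 2))) x =
      ENNReal.ofReal ((Real.sqrt (2 * Real.pi))⁻¹ * Real.exp (-(1 / 2 - s) * x ^ 2)) := by
    intro x
    simp only [Pi.mul_apply, gaussianPDF]
    rw [← ENNReal.ofReal_mul (gaussianPDFReal_nonneg _ _ _), gaussianPDFReal, mul_assoc,
      ← Real.exp_add]
    congr 3
    · simp
    · simp; ring
  simp_rw [h]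
  rw [← ofReal_integral_eq_lintegral_ofReal ((integrable_exp_neg_mul_sq hb).const_mul _)
    (Filter.Eventually.of_forall fun x => by positivity), integral_const_mul, integral_gaussian]
  congr 1
  rw [← Real.sqrt_inv, ← Real.sqrt_mul (by positivity), ← Real.sqrt_inv]
  congr 1
  have : (1 : ℝ) - 2 * s ≠ 0 := by linarith
  have : (1 : ℝ) / 2 - s ≠ 0 := hb.ne'
  field_simp
  try ring

theorem integrable_pow_gaussianReal (v : NNReal) (n : ℕ) :
    Integrable (fun x : ℝ => x ^ n) (gaussianReal 0 v) := by
  have := (memLp_id_gaussianReal (μ := 0) (v := v) n).integrable_norm_pow'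
  refine this.mono' (by fun_prop) (Filter.Eventually.of_forall fun x => by simp)

theorem lintegral_sq_gaussianReal (v : NNReal) :
    ∫⁻ x, ENNReal.ofReal (x ^ 2) ∂(gaussianReal 0 v) = v := by
  rw [← ofReal_integral_eq_lintegral_ofReal (integrable_pow_gaussianReal v 2)
    (Filter.Eventually.of_forall fun x => sq_nonneg x), (gaussianReal_moments v).2.1]
  simp

theorem lintegral_pow_four_gaussianReal (v : NNReal) :
    ∫⁻ x, ENNReal.ofReal (x ^ 4) ∂(gaussianReal 0 v) = 3 * v ^ 2 := by
  rw [← ofReal_integral_eq_lintegral_ofReal (integrable_pow_gaussianReal v 4)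
    (Filter.Eventually.of_forall fun x => by positivity), (gaussianReal_moments v).2.2.2]
  rw [ENNReal.ofReal_mul (by norm_num), ENNReal.ofReal_pow (by positivity)]
  simp

/-! ### Moments of the uniform distribution on the sphere -/

/-- The second moment of the radius needs no explicit density: each coordinate gives `1 = E r² * E
aᵢ²`, and `∑ aᵢ² = 1` on the sphere, so summing over the `d` coordinates yields `E r² = d`. -/
theorem exists_radial_law_inner {d : ℕ} (hd : 1 ≤ d) :
    ∃ ρ : Measure ℝ, IsProbabilityMeasure ρ ∧ ∫⁻ r, ENNReal.ofReal (r ^ 2) ∂ρ = d ∧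
      ∀ u : EuclideanSpace ℝ (Fin d), ‖u‖ = 1 → ∀ φ : ℝ → ℝ≥0∞, Measurable φ →
        ∫⁻ x, φ x ∂(gaussianReal 0 1) =
          ∫⁻ a, ∫⁻ r, φ (r * inner ℝ a u) ∂ρ ∂(uniformSphere d) := by
  obtain ⟨ρ, hρ, h⟩ := exists_radial_law hd
  have key : ∀ u : EuclideanSpace ℝ (Fin d), ‖u‖ = 1 → ∀ φ : ℝ → ℝ≥0∞, Measurable φ →
        ∫⁻ x, φ x ∂(gaussianReal 0 1) =
          ∫⁻ a, ∫⁻ r, φ (r * inner ℝ a u) ∂ρ ∂(uniformSphere d) := by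
    intro u hu φ hφ
    have hu' : ‖u‖₊ = 1 := by ext; simpa using hu
    have h1 := map_inner_stdGaussian u
    rw [hu', one_pow] at h1
    rw [← h1, lintegral_map hφ (by fun_prop), h _ (by fun_prop)]
    simp_rw [real_inner_smul_left]
  refine ⟨ρ, hρ, ?_, key⟩
  set R := ∫⁻ r, ENNReal.ofReal (r ^ 2) ∂ρ
  have := isProbabilityMeasure_uniformSphere hd
  have h1 : ∀ i : Fin d, 1 = R * ∫⁻ a, ENNReal.ofReal (a i ^ 2) ∂(uniformSphere d) := by
    intro i
    have := key (EuclideanSpace.single i 1) (by simp) (fun x => ENNReal.ofReal (x ^ 2))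
      (by fun_prop)
    rw [lintegral_sq_gaussianReal] at this
    simp only [EuclideanSpace.inner_single_right, mul_pow,
      ENNReal.coe_one] at this
    rw [this, ← lintegral_const_mul _ (by fun_prop)]
    refine lintegral_congr fun a => ?_
    simp_rw [ENNReal.ofReal_mul (sq_nonneg _)]
    rw [lintegral_mul_const _ (by fun_prop)]
    simp [R]
  have h2 : ∑ i : Fin d, ∫⁻ a, ENNReal.ofReal (a i ^ 2) ∂(uniformSphere d) = 1 := by
    rw [← lintegral_finsetSum _ (fun i _ => by fun_prop)]
    have : ∀ᵐ a ∂(uniformSphere d), ∑ i : Fin d, ENNReal.ofReal (a i ^ 2) = 1 := by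
      filter_upwards [norm_eq_one_ae_uniformSphere d] with a ha
      rw [← ENNReal.ofReal_sum_of_nonneg (fun i _ => sq_nonneg _),
        ← EuclideanSpace.real_norm_sq_eq, ha]
      simp
    rw [lintegral_congr_ae this]
    simp
  calc R = R * 1 := (mul_one _).symm
    _ = ∑ i : Fin d, (1 : ℝ≥0∞) := by
        rw [← h2, Finset.mul_sum, h2]
        exact Finset.sum_congr rfl fun i _ => (h1 i).symm
    _ = d := by simp

theorem lintegral_inner_sq_uniformSphere {d : ℕ} (hd : 1 ≤ d) {u : EuclideanSpace ℝ (Fin d)}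
    (hu : ‖u‖ = 1) :
    ∫⁻ a, ENNReal.ofReal (inner ℝ a u ^ 2) ∂(uniformSphere d) = (d : ℝ≥0∞)⁻¹ := by
  obtain ⟨ρ, hρ, hR, key⟩ := exists_radial_law_inner hd
  have h := key u hu (fun x => ENNReal.ofReal (x ^ 2)) (by fun_prop)
  rw [lintegral_sq_gaussianReal] at h
  simp_rw [mul_pow, ENNReal.ofReal_mul (sq_nonneg _)] at h
  have h2 : ∀ a : EuclideanSpace ℝ (Fin d),
      ∫⁻ r, ENNReal.ofReal (r ^ 2) * ENNReal.ofReal (inner ℝ a u ^ 2) ∂ρ =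
        d * ENNReal.ofReal (inner ℝ a u ^ 2) := by
    intro a; rw [lintegral_mul_const _ (by fun_prop), hR]
  simp_rw [h2] at h
  rw [lintegral_const_mul _ (by fun_prop)] at h
  exact ENNReal.eq_inv_of_mul_eq_one_left (by rw [mul_comm]; simpa using h.symm)

/-- The Gaussian fourth moment is `3 = E r⁴ * E ⟨a,u⟩⁴`, and `E r⁴ ≥ (E r²)² = d²`. -/
theorem lintegral_inner_pow_four_uniformSphere_le {d : ℕ} (hd : 1 ≤ d)
    {u : EuclideanSpace ℝ (Fin d)} (hu : ‖u‖ = 1) :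
    ∫⁻ a, ENNReal.ofReal (inner ℝ a u ^ 4) ∂(uniformSphere d) ≤ 3 * ((d : ℝ≥0∞) ^ 2)⁻¹ := by
  obtain ⟨ρ, hρ, hR, key⟩ := exists_radial_law_inner hd
  have h := key u hu (fun x => ENNReal.ofReal (x ^ 4)) (by fun_prop)
  rw [lintegral_pow_four_gaussianReal] at h
  simp_rw [mul_pow, ENNReal.ofReal_mul (Even.pow_nonneg (by decide : Even 4) _)] at h
  have h2 : ∀ a : EuclideanSpace ℝ (Fin d),
      ∫⁻ r, ENNReal.ofReal (r ^ 4) * ENNReal.ofReal (inner ℝ a u ^ 4) ∂ρ =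
        (∫⁻ r, ENNReal.ofReal (r ^ 4) ∂ρ) * ENNReal.ofReal (inner ℝ a u ^ 4) := by
    intro a; rw [lintegral_mul_const _ (by fun_prop)]
  simp_rw [h2] at h
  rw [lintegral_const_mul _ (by fun_prop)] at h
  have h4 : (d : ℝ≥0∞) ^ 2 ≤ ∫⁻ r, ENNReal.ofReal (r ^ 4) ∂ρ := by
    -- Jensen's inequality as the integrated form of `2 d r² ≤ r⁴ + d²`.
    have h5 : ∫⁻ r, ENNReal.ofReal (2 * d) * ENNReal.ofReal (r ^ 2) ∂ρ ≤
        ∫⁻ r, (ENNReal.ofReal (r ^ 4) + ENNReal.ofReal ((d : ℝ) ^ 2)) ∂ρ := by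
      refine lintegral_mono fun r => ?_
      rw [← ENNReal.ofReal_mul (by positivity), ← ENNReal.ofReal_add (by positivity)
        (by positivity)]
      exact ENNReal.ofReal_le_ofReal (by nlinarith [sq_nonneg (r ^ 2 - d)])
    rw [lintegral_const_mul _ (by fun_prop), lintegral_add_right _ measurable_const,
      lintegral_const, measure_univ, mul_one, hR, ENNReal.ofReal_mul (by norm_num),
      ENNReal.ofReal_pow (by positivity), ENNReal.ofReal_natCast, mul_assoc, ← sq] at h5
    rw [show ENNReal.ofReal 2 = 2 by simp, two_mul] at h5
    exact (ENNReal.add_le_add_iff_right (by finiteness)).1 h5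
  have hd0 : ((d : ℝ≥0∞) ^ 2) ≠ 0 := by
    have : d ≠ 0 := by omega
    simpa using this
  rw [← ENNReal.div_eq_inv_mul.trans (mul_comm _ _), ENNReal.le_div_iff_mul_le (Or.inl hd0)
    (Or.inl (by finiteness)), mul_comm]
  calc _ ≤ (∫⁻ r, ENNReal.ofReal (r ^ 4) ∂ρ) *
        ∫⁻ a, ENNReal.ofReal (inner ℝ a u ^ 4) ∂(uniformSphere d) := by gcongr
    _ = 3 := by rw [← h]; simp

/-- By Jensen in the radius, replacing `r²` by its mean `d` only decreases the exponential moment,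
so the sphere is dominated by the Gaussian. -/
theorem lintegral_exp_inner_sq_uniformSphere_le {d : ℕ} (hd : 1 ≤ d)
    {u : EuclideanSpace ℝ (Fin d)} (hu : ‖u‖ = 1) {s : ℝ} (hs0 : 0 ≤ s) (hs : s < 1 / 2) :
    ∫⁻ a, ENNReal.ofReal (Real.exp (s * (d * inner ℝ a u ^ 2))) ∂(uniformSphere d) ≤
      ENNReal.ofReal ((Real.sqrt (1 - 2 * s))⁻¹) := by
  obtain ⟨ρ, hρ, hR, key⟩ := exists_radial_law_inner hd
  rw [← lintegral_exp_sq_gaussianReal hs,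
    key u hu (fun x => ENNReal.ofReal (Real.exp (s * x ^ 2))) (by fun_prop)]
  refine lintegral_mono fun a => ?_
  set t : ℝ := inner ℝ a u
  set e : ℝ := Real.exp (s * (d * t ^ 2))
  have he : 0 < e := Real.exp_pos _
  have h5 : ∫⁻ r, (ENNReal.ofReal e + ENNReal.ofReal (e * (s * t ^ 2)) * ENNReal.ofReal (r ^ 2)) ∂ρ
      ≤ ∫⁻ r, (ENNReal.ofReal (Real.exp (s * (r * t) ^ 2)) +
        ENNReal.ofReal (e * (s * t ^ 2)) * d) ∂ρ := by
    refine lintegral_mono fun r => ?_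
    rw [← ENNReal.ofReal_mul (by positivity), ← ENNReal.ofReal_add (by positivity)
        (by positivity), ← ENNReal.ofReal_natCast, ← ENNReal.ofReal_mul (by positivity),
        ← ENNReal.ofReal_add (by positivity) (by positivity)]
    refine ENNReal.ofReal_le_ofReal ?_
    have h6 : Real.exp (s * (r * t) ^ 2) = e * Real.exp (s * (r * t) ^ 2 - s * (d * t ^ 2)) := by
      rw [← Real.exp_add]; ring_nf
    -- Tangent line of the exponential at `r² = d`; its linear term integrates to zero.
    have h7 := Real.add_one_le_exp (s * (r * t) ^ 2 - s * (d * t ^ 2))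
    rw [h6]
    nlinarith [mul_le_mul_of_nonneg_left h7 he.le]
  rw [lintegral_add_left measurable_const, lintegral_const_mul _ (by fun_prop), hR,
    lintegral_add_right _ measurable_const, lintegral_const, lintegral_const, measure_univ,
    mul_one, mul_one] at h5
  exact (ENNReal.add_le_add_iff_right (by finiteness)).1 h5

theorem exists_norm_eq_one_and_eq_smul {E : Type*} [NormedAddCommGroup E] [NormedSpace ℝ E]
    [Nontrivial E] (w : E) : ∃ u : E, ‖u‖ = 1 ∧ w = ‖w‖ • u := by
  by_cases h : w = 0
  · obtain ⟨u, hu⟩ := exists_norm_eq E zero_le_one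
    exact ⟨u, hu, by simp [h]⟩
  · have h' : ‖w‖ ≠ 0 := norm_ne_zero_iff.2 h
    exact ⟨‖w‖⁻¹ • w, by simp [norm_smul, h'], by simp [smul_smul, h']⟩

theorem lintegral_exp_inner_sq_uniformSphere_le_of_norm_le {d : ℕ} (hd : 1 ≤ d)
    {w : EuclideanSpace ℝ (Fin d)} (hw : ‖w‖ ≤ 1) {s : ℝ} (hs0 : 0 ≤ s) (hs : s < 1 / 2) :
    ∫⁻ a, ENNReal.ofReal (Real.exp (s * (d * inner ℝ a w ^ 2))) ∂(uniformSphere d) ≤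
      ENNReal.ofReal ((Real.sqrt (1 - 2 * s))⁻¹) := by
  have : Nonempty (Fin d) := ⟨⟨0, hd⟩⟩
  obtain ⟨u, hu, hwu⟩ := exists_norm_eq_one_and_eq_smul w
  refine le_trans (lintegral_mono fun a => ENNReal.ofReal_le_ofReal (Real.exp_le_exp.2 ?_))
    (lintegral_exp_inner_sq_uniformSphere_le hd hu hs0 hs)
  rw [hwu, real_inner_smul_right, mul_pow]
  have : ‖w‖ ^ 2 ≤ 1 := pow_le_one₀ (norm_nonneg _) hw
  gcongr
  exact mul_le_of_le_one_left (sq_nonneg _) this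

theorem integrable_inner_pow_uniformSphere {d : ℕ} (hd : 1 ≤ d) (w : EuclideanSpace ℝ (Fin d))
    (n : ℕ) : Integrable (fun a => inner ℝ a w ^ n) (uniformSphere d) := by
  have := isProbabilityMeasure_uniformSphere hd
  refine (integrable_const (‖w‖ ^ n)).mono' (by fun_prop) ?_
  filter_upwards [norm_eq_one_ae_uniformSphere d] with a ha
  rw [norm_pow]
  gcongr
  simpa [ha] using norm_inner_le_norm (𝕜 := ℝ) a w

theorem integral_inner_pow_uniformSphere {d : ℕ} {w u : EuclideanSpace ℝ (Fin d)}
    (hwu : w = ‖w‖ • u) {n : ℕ} (hn : Even n) :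
    ∫ a, inner ℝ a w ^ n ∂(uniformSphere d) =
      ‖w‖ ^ n * (∫⁻ a, ENNReal.ofReal (inner ℝ a u ^ n) ∂(uniformSphere d)).toReal := by
  rw [hwu, ← integral_eq_lintegral_of_nonneg_ae
    (Filter.Eventually.of_forall fun a => hn.pow_nonneg _) (by fun_prop), ← hwu,
    ← integral_const_mul]
  refine integral_congr_ae (Filter.Eventually.of_forall fun a => ?_)
  simp only
  rw [← mul_pow, ← real_inner_smul_right, ← hwu]

theorem uniformSphere_moments {d : ℕ} (hd : 1 ≤ d) (w : EuclideanSpace ℝ (Fin d)) :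
    ∫ a, inner ℝ a w ^ 2 ∂(uniformSphere d) = ‖w‖ ^ 2 / d ∧
      ∫ a, inner ℝ a w ^ 4 ∂(uniformSphere d) ≤ 3 * (‖w‖ ^ 2 / d) ^ 2 := by
  have : Nonempty (Fin d) := ⟨⟨0, hd⟩⟩
  have hd0 : (d : ℝ≥0∞) ≠ 0 := by
    have : d ≠ 0 := by omega
    simpa using this
  obtain ⟨u, hu, hwu⟩ := exists_norm_eq_one_and_eq_smul w
  constructor
  · rw [integral_inner_pow_uniformSphere hwu (by decide), lintegral_inner_sq_uniformSphere hd hu]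
    simp [div_eq_mul_inv]
  · rw [integral_inner_pow_uniformSphere hwu (by decide)]
    have h := ENNReal.toReal_mono (ENNReal.mul_ne_top (by finiteness) (ENNReal.inv_ne_top.2 (pow_ne_zero 2 hd0)))
      (lintegral_inner_pow_four_uniformSphere_le hd hu)
    calc _ ≤ ‖w‖ ^ 4 * (3 * ((d : ℝ≥0∞) ^ 2)⁻¹).toReal := by gcongr
      _ = _ := by
        simp only [ENNReal.toReal_mul, ENNReal.toReal_inv, ENNReal.toReal_pow,
          ENNReal.toReal_natCast, ENNReal.toReal_ofNat]
        ring

/-! ### The noise distribution -/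

/-- Comparing characteristic functions also covers the degenerate case `σ = 0`. -/
theorem noiseLaw_eq_map (m : ℕ) (σ : ℝ) :
    noiseLaw m σ = (stdGaussian (EuclideanSpace ℝ (Fin m))).map
      (fun x => Real.sqrt (σ ^ 2 / m) • x) := by
  have hc : 0 ≤ σ ^ 2 / m := by positivity
  have hS : ((σ ^ 2 / (m : ℝ)) • (1 : Matrix (Fin m) (Fin m) ℝ)).PosSemidef :=
    Matrix.PosSemidef.one.smul hc
  have : IsProbabilityMeasure ((stdGaussian (EuclideanSpace ℝ (Fin m))).map
      (fun x => Real.sqrt (σ ^ 2 / m) • x)) :=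
    Measure.isProbabilityMeasure_map (by fun_prop)
  have : IsProbabilityMeasure (noiseLaw m σ) := by unfold noiseLaw; infer_instance
  apply Measure.ext_of_charFun
  ext t
  rw [noiseLaw, charFun_multivariateGaussian hS, charFun_map_smul, charFun_stdGaussian]
  congr 1
  rw [norm_smul, ← Complex.ofReal_pow, mul_pow, Real.norm_eq_abs, sq_abs,
    EuclideanSpace.real_norm_sq_eq, Real.sq_sqrt hc]
  simp only [inner_zero_right, Complex.ofReal_zero, zero_mul, Matrix.smul_mulVec,
    Matrix.one_mulVec, dotProduct, zero_sub, neg_div, Pi.smul_apply, smul_eq_mul, Finset.mul_sum]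
  congr 4
  funext i
  ring

instance isProbabilityMeasure_noiseLaw (m : ℕ) (σ : ℝ) : IsProbabilityMeasure (noiseLaw m σ) := by
  unfold noiseLaw; infer_instance

theorem map_inner_noiseLaw {m : ℕ} (σ : ℝ) (u : EuclideanSpace ℝ (Fin m)) :
    (noiseLaw m σ).map (fun x => inner ℝ x u) =
      gaussianReal 0 (‖Real.sqrt (σ ^ 2 / m) • u‖₊ ^ 2) := by
  rw [noiseLaw_eq_map, Measure.map_map (by fun_prop) (by fun_prop), ← map_inner_stdGaussian]
  congr 1
  ext x
  simp [real_inner_smul_left, real_inner_smul_right]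

theorem lintegral_exp_mul_gaussianReal (v : NNReal) (l : ℝ) :
    ∫⁻ x, ENNReal.ofReal (Real.exp (l * x)) ∂(gaussianReal 0 v) =
      ENNReal.ofReal (Real.exp (v * l ^ 2 / 2)) := by
  rw [← ofReal_integral_eq_lintegral_ofReal (integrable_exp_mul_gaussianReal l)
    (Filter.Eventually.of_forall fun x => (Real.exp_pos _).le)]
  have := congrFun (mgf_id_gaussianReal (μ := 0) (v := v)) l
  simp only [mgf, id] at this
  rw [this]
  simp

theorem lintegral_exp_inner_noiseLaw {m : ℕ} (σ l : ℝ) (u : EuclideanSpace ℝ (Fin m)) :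
    ∫⁻ x, ENNReal.ofReal (Real.exp (l * inner ℝ x u)) ∂(noiseLaw m σ) =
      ENNReal.ofReal (Real.exp (σ ^ 2 / m * ‖u‖ ^ 2 * l ^ 2 / 2)) := by
  have h := lintegral_map (μ := noiseLaw m σ)
    (f := fun x : ℝ => ENNReal.ofReal (Real.exp (l * x))) (by fun_prop)
    (g := fun x => inner ℝ x u) (by fun_prop)
  rw [← h, map_inner_noiseLaw, lintegral_exp_mul_gaussianReal]
  congr 3
  simp only [NNReal.coe_pow, coe_nnnorm, norm_smul, mul_pow, Real.norm_eq_abs, sq_abs]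
  rw [Real.sq_sqrt (by positivity)]

theorem lintegral_exp_norm_sq_noiseLaw {m : ℕ} {σ s : ℝ} (hs : s * (σ ^ 2 / m) < 1 / 2) :
    ∫⁻ x, ENNReal.ofReal (Real.exp (s * ‖x‖ ^ 2)) ∂(noiseLaw m σ) =
      ENNReal.ofReal ((Real.sqrt (1 - 2 * (s * (σ ^ 2 / m))))⁻¹) ^ m := by
  have hc : 0 ≤ σ ^ 2 / m := by positivity
  rw [noiseLaw_eq_map, lintegral_map (by fun_prop) (by fun_prop), ← map_pi_eq_stdGaussian,
    lintegral_map (by fun_prop) (by fun_prop)]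
  have h : ∀ x : Fin m → ℝ, ENNReal.ofReal (Real.exp (s * ‖Real.sqrt (σ ^ 2 / m) •
      (WithLp.toLp 2 x : EuclideanSpace ℝ (Fin m))‖ ^ 2)) =
      ∏ i, ENNReal.ofReal (Real.exp (s * (σ ^ 2 / m) * x i ^ 2)) := by
    intro x
    rw [← ENNReal.ofReal_prod_of_nonneg (fun i _ => (Real.exp_pos _).le), ← Real.exp_sum,
      norm_smul, mul_pow, Real.norm_eq_abs, sq_abs, Real.sq_sqrt hc,
      EuclideanSpace.real_norm_sq_eq, ← Finset.mul_sum, mul_assoc]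
  simp_rw [h]
  rw [lintegral_pi_prod_eq_prod (fun _ : Fin m => gaussianReal 0 1)
    (fun _ x => ENNReal.ofReal (Real.exp (s * (σ ^ 2 / m) * x ^ 2))) (fun i => by fun_prop)]
  simp [lintegral_exp_sq_gaussianReal hs]

/-! ### Tail bounds -/

theorem measure_le_exp_mul_lintegral {Ω : Type*} [MeasurableSpace Ω] {μ : Measure Ω} {Y : Ω → ℝ}
    (hY : AEMeasurable Y μ) {l : ℝ} (hl : 0 ≤ l) (K : ℝ) :
    μ {x | K ≤ Y x} ≤
      ENNReal.ofReal (Real.exp (-(l * K))) * ∫⁻ x, ENNReal.ofReal (Real.exp (l * Y x)) ∂μ := by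
  have h := mul_meas_ge_le_lintegral₀ (μ := μ)
    (f := fun x => ENNReal.ofReal (Real.exp (l * Y x))) (by fun_prop)
    (ENNReal.ofReal (Real.exp (l * K)))
  have h1 : μ {x | K ≤ Y x} ≤ μ {x | ENNReal.ofReal (Real.exp (l * K)) ≤
      ENNReal.ofReal (Real.exp (l * Y x))} :=
    measure_mono fun x hx => ENNReal.ofReal_le_ofReal
      (Real.exp_le_exp.2 (mul_le_mul_of_nonneg_left hx hl))
  calc μ {x | K ≤ Y x} = ENNReal.ofReal (Real.exp (-(l * K))) *
        (ENNReal.ofReal (Real.exp (l * K)) * μ {x | K ≤ Y x}) := by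
        rw [← mul_assoc, ← ENNReal.ofReal_mul (Real.exp_pos _).le, ← Real.exp_add]
        simp
    _ ≤ _ := by gcongr; exact le_trans (by gcongr) h

theorem measure_abs_le_exp_mul_lintegral {Ω : Type*} [MeasurableSpace Ω] {μ : Measure Ω}
    {Y : Ω → ℝ} (hY : AEMeasurable Y μ) {l : ℝ} (hl : 0 ≤ l) (K : ℝ) {C : ℝ≥0∞}
    (h1 : ∫⁻ x, ENNReal.ofReal (Real.exp (l * Y x)) ∂μ ≤ C)
    (h2 : ∫⁻ x, ENNReal.ofReal (Real.exp (-l * Y x)) ∂μ ≤ C) :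
    μ {x | K ≤ |Y x|} ≤ ENNReal.ofReal (2 * Real.exp (-(l * K))) * C := by
  have h : {x | K ≤ |Y x|} = {x | K ≤ Y x} ∪ {x | K ≤ -Y x} := by
    ext x; simp [le_abs]
  have h3 := measure_le_exp_mul_lintegral hY hl K
  have h4 := measure_le_exp_mul_lintegral hY.neg hl K
  simp only [Pi.neg_apply, mul_neg, ← neg_mul] at h4
  rw [h]
  calc _ ≤ _ := measure_union_le _ _
    _ ≤ ENNReal.ofReal (Real.exp (-(l * K))) * C + ENNReal.ofReal (Real.exp (-(l * K))) * C := by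
      refine add_le_add (h3.trans (by gcongr)) (le_trans h4 ?_)
      simp only [neg_mul] at h2 ⊢
      gcongr
    _ = _ := by
      rw [← two_mul, ← mul_assoc, ENNReal.ofReal_mul (by norm_num)]
      simp

theorem noiseLaw_zero_ae (m : ℕ) : ∀ᵐ x ∂(noiseLaw m 0), x = 0 := by
  rw [noiseLaw_eq_map, ae_map_iff (by fun_prop) (measurableSet_eq_fun (by fun_prop) (by fun_prop))]
  simp

theorem noiseLaw_inner_lt_neg_le {m : ℕ} {σ l : ℝ} (hm : 0 < m) (hσ : 0 ≤ σ) (hl : 0 < l)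
    {u : EuclideanSpace ℝ (Fin m)} (hu : ‖u‖ = 1) :
    noiseLaw m σ {e | inner ℝ e u < -(2 * (σ * Real.sqrt (l / m)))} ≤
      ENNReal.ofReal (Real.exp (-(2 * l))) := by
  rcases hσ.eq_or_lt with rfl | hσ
  · refine le_of_eq_of_le (measure_eq_zero_iff_ae_notMem.2 ?_) zero_le
    filter_upwards [noiseLaw_zero_ae m] with x hx
    simp [hx]
  have hm' : (0 : ℝ) < m := by exact_mod_cast hm
  have hs : Real.sqrt (l / m) ^ 2 = l / m := Real.sq_sqrt (by positivity)
  have hs0 : 0 < Real.sqrt (l / m) := Real.sqrt_pos.2 (by positivity)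
  set s := Real.sqrt (l / m)
  -- The Chernoff parameter is threshold over variance, `2σs / (σ²/m)`, which is optimal for a
  -- Gaussian. It divides by `σ`, hence the separate case `σ = 0`.
  have h := measure_le_exp_mul_lintegral (μ := noiseLaw m σ) (Y := fun e => inner ℝ e (-u))
    (by fun_prop) (l := 2 * m * s / σ) (by positivity) (2 * (σ * s))
  rw [lintegral_exp_inner_noiseLaw, ← ENNReal.ofReal_mul (Real.exp_pos _).le, ← Real.exp_add,
    norm_neg, hu] at h
  refine (measure_mono ?_).trans (h.trans (ENNReal.ofReal_le_ofReal (Real.exp_le_exp.2 ?_)))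
  · intro e he
    simp only [Set.mem_ofPred_eq, inner_neg_right] at he ⊢
    linarith
  · have h1 : -(2 * m * s / σ * (2 * (σ * s))) = -(4 * (m * s ^ 2)) := by
      field_simp; ring
    have h2 : σ ^ 2 / m * 1 ^ 2 * (2 * m * s / σ) ^ 2 / 2 = 2 * (m * s ^ 2) := by
      field_simp
    have h3 : m * s ^ 2 = l := by rw [hs]; field_simp
    rw [h1, h2, h3]; linarith

/-- For fixed unit vectors the sum is Gaussian of variance `2σ²/m`, and `(4σs)² / (4σ²/m) = 4l`. -/
theorem noiseLaw_prod_inner_add_inner_le {m : ℕ} {σ l : ℝ} (hm : 0 < m) (hσ : 0 ≤ σ)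
    (hl : 0 < l) {u v : EuclideanSpace ℝ (Fin m)} (hu : ‖u‖ = 1) (hv : ‖v‖ = 1) :
    ((noiseLaw m σ).prod (noiseLaw m σ))
      {p | 4 * (σ * Real.sqrt (l / m)) < |inner ℝ p.1 u + inner ℝ p.2 v|} ≤
      ENNReal.ofReal (2 * Real.exp (-(4 * l))) := by
  rcases hσ.eq_or_lt with rfl | hσ
  · refine le_of_eq_of_le (measure_eq_zero_iff_ae_notMem.2 ?_) zero_le
    have h1 := Measure.quasiMeasurePreserving_fst (μ := noiseLaw m 0) (ν := noiseLaw m 0) |>.ae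
      (noiseLaw_zero_ae m)
    have h2 := Measure.quasiMeasurePreserving_snd (μ := noiseLaw m 0) (ν := noiseLaw m 0) |>.ae
      (noiseLaw_zero_ae m)
    filter_upwards [h1, h2] with x hx hy
    simp [hx, hy]
  have hm' : (0 : ℝ) < m := by exact_mod_cast hm
  have hs : Real.sqrt (l / m) ^ 2 = l / m := Real.sq_sqrt (by positivity)
  have hs0 : 0 < Real.sqrt (l / m) := Real.sqrt_pos.2 (by positivity)
  set s := Real.sqrt (l / m)
  have h3 : m * s ^ 2 = l := by rw [hs]; field_simp
  have hmgf : ∀ t : ℝ, t ^ 2 = (2 * m * s / σ) ^ 2 →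
      ∫⁻ p, ENNReal.ofReal (Real.exp (t * (inner ℝ p.1 u + inner ℝ p.2 v)))
        ∂((noiseLaw m σ).prod (noiseLaw m σ)) ≤ ENNReal.ofReal (Real.exp (4 * l)) := by
    intro t ht
    simp_rw [mul_add, Real.exp_add, ENNReal.ofReal_mul (Real.exp_pos _).le]
    rw [lintegral_prod_mul (f := fun x => ENNReal.ofReal (Real.exp (t * inner ℝ x u)))
      (g := fun x => ENNReal.ofReal (Real.exp (t * inner ℝ x v))) (by fun_prop) (by fun_prop),
      lintegral_exp_inner_noiseLaw,
      lintegral_exp_inner_noiseLaw, ← ENNReal.ofReal_mul (Real.exp_pos _).le, ← Real.exp_add,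
      hu, hv, ht]
    refine ENNReal.ofReal_le_ofReal (Real.exp_le_exp.2 (le_of_eq ?_))
    rw [← h3]; field_simp; ring
  have h := measure_abs_le_exp_mul_lintegral
    (μ := (noiseLaw m σ).prod (noiseLaw m σ)) (Y := fun p => inner ℝ p.1 u + inner ℝ p.2 v)
    (by fun_prop) (l := 2 * m * s / σ) (by positivity) (4 * (σ * s)) (hmgf _ rfl)
    (hmgf _ (neg_sq _))
  refine (measure_mono (Set.ofPred_subset_ofPred.2 fun p hp => le_of_lt hp)).trans (h.trans ?_)
  rw [← ENNReal.ofReal_mul (by positivity), mul_assoc, ← Real.exp_add]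
  refine ENNReal.ofReal_le_ofReal (le_of_eq ?_)
  congr 2
  rw [← h3]; field_simp; ring

/-- After squaring, `(1 - x)(1 + 6x/5) ≥ 1` is needed, which for `x > 0` means exactly `x ≤ 1/6`.
This is where `m ≥ 6 log N` enters. -/
theorem inv_sqrt_one_sub_le_exp {x : ℝ} (h0 : 0 ≤ x) (h1 : x ≤ 1 / 6) :
    (Real.sqrt (1 - x))⁻¹ ≤ Real.exp (3 / 5 * x) := by
  have hx : 0 < 1 - x := by linarith
  rw [← Real.sqrt_inv]
  refine Real.sqrt_le_iff.2 ⟨(Real.exp_pos _).le, ?_⟩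
  rw [← Real.exp_nat_mul]
  have h2 := Real.add_one_le_exp (((2 : ℕ) : ℝ) * (3 / 5 * x))
  refine le_trans ?_ h2
  rw [inv_le_iff_one_le_mul₀ hx]
  push_cast
  nlinarith

/-- Given one noise vector `f`, the inner product is Gaussian with variance proportional to `‖f‖²`;
integrating over `f` gives a chi-square exponential moment `(1 - l/m)^(-m/2) ≤ exp(3l/5)`. -/
theorem noiseLaw_prod_inner_le {m : ℕ} {σ l : ℝ} (hm : 0 < m) (hσ : 0 ≤ σ)
    (hl : 0 < l) (hml : 6 * l ≤ m) :
    ((noiseLaw m σ).prod (noiseLaw m σ))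
      {p | 24 / 5 * (σ ^ 2 * Real.sqrt (l / m)) < |inner ℝ p.1 p.2|} ≤
      ENNReal.ofReal (2 * Real.exp (-(4 * l))) := by
  rcases hσ.eq_or_lt with rfl | hσ
  · refine le_of_eq_of_le (measure_eq_zero_iff_ae_notMem.2 ?_) zero_le
    have h1 := Measure.quasiMeasurePreserving_fst (μ := noiseLaw m 0) (ν := noiseLaw m 0) |>.ae
      (noiseLaw_zero_ae m)
    filter_upwards [h1] with x hx
    simp [hx]
  have hm' : (0 : ℝ) < m := by exact_mod_cast hm
  have hs : Real.sqrt (l / m) ^ 2 = l / m := Real.sq_sqrt (by positivity)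
  have hs0 : 0 < Real.sqrt (l / m) := Real.sqrt_pos.2 (by positivity)
  set s := Real.sqrt (l / m)
  have h3 : m * s ^ 2 = l := by rw [hs]; field_simp
  have hlm : l / m ≤ 1 / 6 := by rw [div_le_iff₀ hm']; linarith
  have hmgf : ∀ t : ℝ, t ^ 2 = (m * s / σ ^ 2) ^ 2 →
      ∫⁻ p, ENNReal.ofReal (Real.exp (t * inner ℝ p.1 p.2))
        ∂((noiseLaw m σ).prod (noiseLaw m σ)) ≤ ENNReal.ofReal (Real.exp (3 / 5 * l)) := by
    intro t ht
    rw [lintegral_prod_symm' _ (by fun_prop)]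
    simp_rw [lintegral_exp_inner_noiseLaw]
    have h4 : ∀ f : EuclideanSpace ℝ (Fin m), σ ^ 2 / m * ‖f‖ ^ 2 * t ^ 2 / 2 =
        (l / (2 * σ ^ 2)) * ‖f‖ ^ 2 := by
      intro f
      rw [ht, ← h3]; field_simp
    have h5 : l / (2 * σ ^ 2) * (σ ^ 2 / m) = l / m / 2 := by field_simp
    simp_rw [h4]
    rw [lintegral_exp_norm_sq_noiseLaw (by rw [h5]; linarith), h5,
      ← ENNReal.ofReal_pow (by positivity)]
    refine ENNReal.ofReal_le_ofReal ?_
    calc _ ≤ (Real.exp (3 / 5 * (l / m))) ^ m := by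
          gcongr
          rw [mul_div_cancel₀ _ (two_ne_zero)]
          exact inv_sqrt_one_sub_le_exp (by positivity) hlm
      _ = _ := by
          rw [← Real.exp_nat_mul]
          congr 1; field_simp
  have h := measure_abs_le_exp_mul_lintegral
    (μ := (noiseLaw m σ).prod (noiseLaw m σ)) (Y := fun p => inner ℝ p.1 p.2)
    (by fun_prop) (l := m * s / σ ^ 2) (by positivity) (24 / 5 * (σ ^ 2 * s)) (hmgf _ rfl)
    (hmgf _ (neg_sq _))
  refine (measure_mono (Set.ofPred_subset_ofPred.2 fun p hp => le_of_lt hp)).trans (h.trans ?_)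
  rw [← ENNReal.ofReal_mul (by positivity), mul_assoc, ← Real.exp_add]
  refine ENNReal.ofReal_le_ofReal ?_
  gcongr
  -- The exponent is `-24/5 l + 3/5 l = -21/5 l`, slightly better than required.
  have h6 : m * s / σ ^ 2 * (24 / 5 * (σ ^ 2 * s)) = 24 / 5 * (m * s ^ 2) := by field_simp
  rw [h6, h3]; linarith

/-! ### Bilinear forms in two independent uniform points of spheres -/

/-- The Frobenius norm of a matrix. -/
noncomputable def frobenius {d d' : ℕ} (M : Matrix (Fin d) (Fin d') ℝ) : ℝ :=
  Real.sqrt (∑ i, ∑ j, M i j ^ 2)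

/-- `‖Mb‖² / ‖M‖_F²` is a convex combination, with weights `‖rowᵢ‖² / ‖M‖_F²`, of the squared inner
products of `b` with the normalised rows. Convexity of `exp` reduces to a single row. -/
theorem lintegral_exp_norm_sq_toEuclideanLin_le {d d' : ℕ} (hd' : 1 ≤ d')
    (M : Matrix (Fin d) (Fin d') ℝ) (hM : 0 < frobenius M) {s : ℝ} (hs0 : 0 ≤ s)
    (hs : s < 1 / 2) :
    ∫⁻ b, ENNReal.ofReal (Real.exp (s * (d' * (‖M.toEuclideanLin b‖ ^ 2 / frobenius M ^ 2))))
      ∂(uniformSphere d') ≤ ENNReal.ofReal ((Real.sqrt (1 - 2 * s))⁻¹) := by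
  let row : Fin d → EuclideanSpace ℝ (Fin d') := fun i => WithLp.toLp 2 (M i)
  set F := frobenius M
  have hF : ∑ i, ‖row i‖ ^ 2 = F ^ 2 := by
    simp only [F, frobenius]
    rw [Real.sq_sqrt (by positivity)]
    exact Finset.sum_congr rfl fun i _ => by rw [EuclideanSpace.real_norm_sq_eq]
  have hF0 : 0 < F ^ 2 := by positivity
  have hw : ∑ i, ‖row i‖ ^ 2 / F ^ 2 = 1 := by rw [← Finset.sum_div, hF, div_self hF0.ne']
  have hpt : ∀ b : EuclideanSpace ℝ (Fin d'),
      Real.exp (s * (d' * (‖M.toEuclideanLin b‖ ^ 2 / F ^ 2))) ≤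
        ∑ i, ‖row i‖ ^ 2 / F ^ 2 *
          Real.exp (s * (d' * inner ℝ b (‖row i‖⁻¹ • row i) ^ 2)) := by
    intro b
    have h := convexOn_exp.map_sum_le (t := Finset.univ) (w := fun i => ‖row i‖ ^ 2 / F ^ 2)
      (p := fun i => s * (d' * inner ℝ b (‖row i‖⁻¹ • row i) ^ 2)) (fun i _ => by positivity) hw
      (fun i _ => Set.mem_univ _)
    simp only [smul_eq_mul] at h
    refine le_trans (le_of_eq ?_) h
    congr 1
    rw [EuclideanSpace.real_norm_sq_eq, Finset.sum_div, Finset.mul_sum, Finset.mul_sum]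
    refine Finset.sum_congr rfl fun i _ => ?_
    have h1 : M.toEuclideanLin b i = inner ℝ b (row i) := by
      simp [row, Matrix.toLpLin_apply, Matrix.mulVec, dotProduct, PiLp.inner_apply]
    rw [h1, real_inner_smul_right]
    by_cases h0 : ‖row i‖ = 0
    · have : row i = 0 := norm_eq_zero.1 h0
      simp [this]
    · field_simp
  calc _ ≤ ∫⁻ b, ∑ i, ENNReal.ofReal (‖row i‖ ^ 2 / F ^ 2) * ENNReal.ofReal
          (Real.exp (s * (d' * inner ℝ b (‖row i‖⁻¹ • row i) ^ 2))) ∂(uniformSphere d') := by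
        refine lintegral_mono fun b => (ENNReal.ofReal_le_ofReal (hpt b)).trans (le_of_eq ?_)
        rw [ENNReal.ofReal_sum_of_nonneg fun i _ => by positivity]
        exact Finset.sum_congr rfl fun i _ => ENNReal.ofReal_mul (by positivity)
    _ = ∑ i, ENNReal.ofReal (‖row i‖ ^ 2 / F ^ 2) * ∫⁻ b, ENNReal.ofReal
          (Real.exp (s * (d' * inner ℝ b (‖row i‖⁻¹ • row i) ^ 2))) ∂(uniformSphere d') := by
        rw [lintegral_finsetSum _ fun i _ => by fun_prop]
        exact Finset.sum_congr rfl fun i _ => lintegral_const_mul _ (by fun_prop)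
    _ ≤ ∑ i, ENNReal.ofReal (‖row i‖ ^ 2 / F ^ 2) * ENNReal.ofReal ((Real.sqrt (1 - 2 * s))⁻¹) := by
        gcongr with i
        refine lintegral_exp_inner_sq_uniformSphere_le_of_norm_le hd' ?_ hs0 hs
        rw [norm_smul, norm_inv, norm_norm]
        exact inv_mul_le_one
    _ = _ := by
        rw [← Finset.sum_mul, ← ENNReal.ofReal_sum_of_nonneg fun i _ => by positivity, hw]
        simp

/-- Write the form as `‖Mb‖ * ⟨a, w⟩` with `w` the direction of `Mb`. The inequality `2xy ≤ x² + y²`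
separates the factors, and two exponential moments at `s = 5/16` multiply to `1/(1 - 5/8) = 8/3`. -/
theorem uniformSphere_prod_bilinear_le {d d' : ℕ} (hd : 1 ≤ d) (hd' : 1 ≤ d')
    (M : Matrix (Fin d) (Fin d') ℝ) (K : ℝ) :
    ((uniformSphere d).prod (uniformSphere d'))
      {p | K * (frobenius M / (Real.sqrt d * Real.sqrt d')) <
        |inner ℝ p.1 (M.toEuclideanLin p.2)|} ≤
      ENNReal.ofReal (8 / 3 * Real.exp (-(5 / 8 * K))) := by
  have := isProbabilityMeasure_uniformSphere hd
  have := isProbabilityMeasure_uniformSphere hd'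
  have hF0 : 0 ≤ frobenius M := Real.sqrt_nonneg _
  rcases hF0.eq_or_lt with hF | hF
  · have hM : M = 0 := by
      have h := (Real.sqrt_eq_zero (by positivity)).1 hF.symm
      ext i j
      have h1 := (Finset.sum_eq_zero_iff_of_nonneg fun i _ => by positivity).1 h i
        (Finset.mem_univ i)
      have h2 := (Finset.sum_eq_zero_iff_of_nonneg fun j _ => by positivity).1 h1 j
        (Finset.mem_univ j)
      simpa using h2
    simp [hM, frobenius]
  have hc : Continuous M.toEuclideanLin := LinearMap.continuous_of_finiteDimensional _
  have hcm := hc.measurable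
  set F := frobenius M
  have hd0 : (0 : ℝ) < d := by exact_mod_cast hd
  have hd0' : (0 : ℝ) < d' := by exact_mod_cast hd'
  set D := Real.sqrt d * Real.sqrt d'
  have hD : 0 < D := by positivity
  have h := measure_le_exp_mul_lintegral (μ := (uniformSphere d).prod (uniformSphere d'))
    (Y := fun p => D / F * |inner ℝ p.1 (M.toEuclideanLin p.2)|) (by fun_prop)
    (l := 5 / 8) (by norm_num) K
  -- If `Mb = 0` then `w b = 0`, which is why the moment bound is used for vectors of norm at most
  -- 1.
  let w : EuclideanSpace ℝ (Fin d') → EuclideanSpace ℝ (Fin d) :=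
    fun b => ‖M.toEuclideanLin b‖⁻¹ • M.toEuclideanLin b
  have hw : Measurable w := by fun_prop
  have hpt : ∀ p : EuclideanSpace ℝ (Fin d) × EuclideanSpace ℝ (Fin d'),
      ENNReal.ofReal (Real.exp (5 / 8 * (D / F * |inner ℝ p.1 (M.toEuclideanLin p.2)|))) ≤
      ENNReal.ofReal (Real.exp (5 / 16 * (d' * (‖M.toEuclideanLin p.2‖ ^ 2 / F ^ 2)))) *
      ENNReal.ofReal (Real.exp (5 / 16 * (d * inner ℝ p.1 (w p.2) ^ 2))) := by
    intro p
    rw [← ENNReal.ofReal_mul (Real.exp_pos _).le, ← Real.exp_add]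
    refine ENNReal.ofReal_le_ofReal (Real.exp_le_exp.2 ?_)
    have h1 : |inner ℝ p.1 (M.toEuclideanLin p.2)| =
        ‖M.toEuclideanLin p.2‖ * |inner ℝ p.1 (w p.2)| := by
      simp only [w, real_inner_smul_right, abs_mul, abs_inv, abs_norm]
      by_cases h0 : ‖M.toEuclideanLin p.2‖ = 0
      · simp [norm_eq_zero.1 h0]
      · field_simp
    rw [h1]
    have h2 := two_mul_le_add_sq (Real.sqrt d' * (‖M.toEuclideanLin p.2‖ / F))
      (Real.sqrt d * |inner ℝ p.1 (w p.2)|)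
    simp only [mul_pow, div_pow, Real.sq_sqrt hd0.le, Real.sq_sqrt hd0'.le, sq_abs] at h2
    calc _ = 5 / 16 * (2 * (Real.sqrt d' * (‖M.toEuclideanLin p.2‖ / F)) *
          (Real.sqrt d * |inner ℝ p.1 (w p.2)|)) := by simp only [D]; ring
      _ ≤ _ := by linarith
  have hnum : (Real.sqrt (1 - 2 * (5 / 16)))⁻¹ * (Real.sqrt (1 - 2 * (5 / 16)))⁻¹ = 8 / 3 := by
    rw [← mul_inv, Real.mul_self_sqrt (by norm_num)]; norm_num
  have hint : ∫⁻ p, ENNReal.ofReal (Real.exp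
      (5 / 8 * (D / F * |inner ℝ p.1 (M.toEuclideanLin p.2)|)))
      ∂((uniformSphere d).prod (uniformSphere d')) ≤ ENNReal.ofReal (8 / 3) := by
    refine (lintegral_mono hpt).trans ?_
    rw [lintegral_prod_symm' _ (by fun_prop)]
    calc _ ≤ ∫⁻ b, ENNReal.ofReal
          (Real.exp (5 / 16 * (d' * (‖M.toEuclideanLin b‖ ^ 2 / F ^ 2)))) *
          ENNReal.ofReal ((Real.sqrt (1 - 2 * (5 / 16)))⁻¹) ∂(uniformSphere d') := by
          refine lintegral_mono fun b => ?_
          simp only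
          rw [lintegral_const_mul _ (by fun_prop)]
          gcongr
          refine lintegral_exp_inner_sq_uniformSphere_le_of_norm_le hd ?_ (by norm_num)
            (by norm_num)
          simp only [w]
          rw [norm_smul, norm_inv, norm_norm]
          exact inv_mul_le_one
      _ ≤ _ := by
          rw [lintegral_mul_const _ (by fun_prop), ← hnum, ENNReal.ofReal_mul (by positivity)]
          gcongr
          exact lintegral_exp_norm_sq_toEuclideanLin_le hd' M hF (by norm_num) (by norm_num)
  refine (measure_mono ?_).trans (h.trans ?_)
  · intro p hp
    simp only [Set.mem_ofPred_eq] at hp ⊢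
    calc K = D / F * (K * (F / D)) := by field_simp
      _ ≤ _ := by gcongr
  · rw [mul_comm (8 / 3 : ℝ), ENNReal.ofReal_mul (Real.exp_pos _).le]
    gcongr

/-! ### Small ball probabilities and the number of large inner products -/

/-- Markov's inequality for `(X² - 7v/2)²`, a Cantelli-type shift of the second moment. Its mean is
at most `(3 - 7 + 49/4)v² = 33/4 v²`, while `X² ≤ 25/144 v` makes it at least `11v²`; the ratio is
`3/4`. -/
theorem measure_abs_lt_le_of_moments {Ω : Type*} [MeasurableSpace Ω] {μ : Measure Ω}
    [IsProbabilityMeasure μ] {X : Ω → ℝ} {v t : ℝ} (h2i : Integrable (fun ω => X ω ^ 2) μ)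
    (h4i : Integrable (fun ω => X ω ^ 4) μ) (h2 : ∫ ω, X ω ^ 2 ∂μ = v)
    (h4 : ∫ ω, X ω ^ 4 ∂μ ≤ 3 * v ^ 2) (ht : t ≤ 5 / 12 * Real.sqrt v) :
    μ {ω | |X ω| < t} ≤ ENNReal.ofReal (3 / 4) := by
  have hv0 : 0 ≤ v := h2 ▸ integral_nonneg fun ω => sq_nonneg _
  rcases hv0.eq_or_lt with hv | hv
  · have : {ω | |X ω| < t} = ∅ := by
      ext ω
      simp only [Set.mem_ofPred_eq, Set.mem_empty_iff_false, iff_false, not_lt]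
      rw [← hv, Real.sqrt_zero, mul_zero] at ht
      exact ht.trans (abs_nonneg _)
    rw [this]; simp
  have hexp : ∀ ω, (X ω ^ 2 - 7 / 2 * v) ^ 2 =
      X ω ^ 4 - 7 * v * X ω ^ 2 + 49 / 4 * v ^ 2 := fun ω => by ring
  have hint : Integrable (fun ω => (X ω ^ 2 - 7 / 2 * v) ^ 2) μ := by
    simp_rw [hexp]
    exact (h4i.sub (h2i.const_mul _)).add (integrable_const _)
  have hI : ∫ ω, (X ω ^ 2 - 7 / 2 * v) ^ 2 ∂μ ≤ 33 / 4 * v ^ 2 := by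
    simp_rw [hexp]
    have hsub : Integrable (fun ω => X ω ^ 4 - 7 * v * X ω ^ 2) μ := h4i.sub (h2i.const_mul _)
    rw [integral_add hsub (integrable_const _),
      integral_sub h4i (h2i.const_mul _), integral_const_mul, h2]
    simp
    nlinarith
  have hM := mul_meas_ge_le_integral_of_nonneg
    (Filter.Eventually.of_forall fun ω => sq_nonneg (X ω ^ 2 - 7 / 2 * v)) hint
    (11 * v ^ 2)
  have hle : μ.real {ω | 11 * v ^ 2 ≤ (X ω ^ 2 - 7 / 2 * v) ^ 2} ≤ 3 / 4 := by
    have : 0 < v ^ 2 := by positivity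
    by_contra hcon
    push Not at hcon
    nlinarith
  calc μ {ω | |X ω| < t} ≤ μ {ω | 11 * v ^ 2 ≤ (X ω ^ 2 - 7 / 2 * v) ^ 2} := by
        refine measure_mono (Set.ofPred_subset_ofPred.2 fun ω hω => ?_)
        have h1 : |X ω| < 5 / 12 * Real.sqrt v := hω.trans_le ht
        have h5 : X ω ^ 2 ≤ 25 / 144 * v := by
          rw [← sq_abs]
          calc |X ω| ^ 2 ≤ (5 / 12 * Real.sqrt v) ^ 2 := by gcongr
            _ = _ := by rw [mul_pow, Real.sq_sqrt hv.le]; norm_num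
        nlinarith [sq_nonneg (X ω)]
    _ = ENNReal.ofReal (μ.real {ω | 11 * v ^ 2 ≤ (X ω ^ 2 - 7 / 2 * v) ^ 2}) := by
        simp [measureReal_def]
    _ ≤ _ := ENNReal.ofReal_le_ofReal hle

/-- The Gaussian's odd moments vanish, so with `A = ‖w‖²/d` the second moment is `A + V` and the
fourth at most `3A² + 6AV + 3V²`. The noise only enlarges the variance. -/
theorem uniformSphere_prod_noiseLaw_small_ball {d m : ℕ} (hd : 1 ≤ d) (σ : ℝ)
    (w : EuclideanSpace ℝ (Fin d)) (y : EuclideanSpace ℝ (Fin m)) {t : ℝ}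
    (ht : t ≤ 5 / 12 * (‖w‖ / Real.sqrt d)) :
    ((uniformSphere d).prod (noiseLaw m σ)) {p | |inner ℝ p.1 w + inner ℝ p.2 y| < t} ≤
      ENNReal.ofReal (3 / 4) := by
  have := isProbabilityMeasure_uniformSphere hd
  have hA := integrable_inner_pow_uniformSphere hd w
  set V : NNReal := ‖Real.sqrt (σ ^ 2 / m) • y‖₊ ^ 2
  have hmap : (noiseLaw m σ).map (fun x => inner ℝ x y) = gaussianReal 0 V :=
    map_inner_noiseLaw σ y
  have hG : ∀ n, Integrable (fun x => inner ℝ x y ^ n) (noiseLaw m σ) := by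
    intro n
    have h := integrable_pow_gaussianReal V n
    rw [← hmap] at h
    exact h.comp_measurable (by fun_prop)
  have hGi : ∀ n, ∫ x, inner ℝ x y ^ n ∂(noiseLaw m σ) = ∫ x, x ^ n ∂(gaussianReal 0 V) := by
    intro n
    rw [← hmap, integral_map (by fun_prop) (by fun_prop)]
  obtain ⟨g1, g2, g3, g4⟩ := gaussianReal_moments V
  have g1' : ∫ x, inner ℝ x y ^ 1 ∂(noiseLaw m σ) = 0 := (hGi 1).trans (by simp)
  rw [← hGi] at g2 g3 g4
  obtain ⟨a2, a4⟩ := uniformSphere_moments hd w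
  have hm : ∀ i j, Integrable (fun p : EuclideanSpace ℝ (Fin d) × EuclideanSpace ℝ (Fin m) =>
      inner ℝ p.1 w ^ i * inner ℝ p.2 y ^ j) ((uniformSphere d).prod (noiseLaw m σ)) :=
    fun i j => (hA i).mul_prod (hG j)
  have hmi : ∀ i j, ∫ p, inner ℝ p.1 w ^ i * inner ℝ p.2 y ^ j
      ∂((uniformSphere d).prod (noiseLaw m σ)) =
      (∫ a, inner ℝ a w ^ i ∂(uniformSphere d)) * ∫ x, inner ℝ x y ^ j ∂(noiseLaw m σ) :=
    fun i j => integral_prod_mul (fun a => inner ℝ a w ^ i) (fun x => inner ℝ x y ^ j)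
  -- Zeroth and first powers are kept so that `hm` and `hmi` apply to every term.
  have e2 : ∀ p : EuclideanSpace ℝ (Fin d) × EuclideanSpace ℝ (Fin m),
      (inner ℝ p.1 w + inner ℝ p.2 y) ^ 2 = inner ℝ p.1 w ^ 2 * inner ℝ p.2 y ^ 0 +
        2 * (inner ℝ p.1 w ^ 1 * inner ℝ p.2 y ^ 1) + inner ℝ p.1 w ^ 0 * inner ℝ p.2 y ^ 2 :=
    fun p => by ring
  have e4 : ∀ p : EuclideanSpace ℝ (Fin d) × EuclideanSpace ℝ (Fin m),
      (inner ℝ p.1 w + inner ℝ p.2 y) ^ 4 = inner ℝ p.1 w ^ 4 * inner ℝ p.2 y ^ 0 +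
        4 * (inner ℝ p.1 w ^ 3 * inner ℝ p.2 y ^ 1) +
        6 * (inner ℝ p.1 w ^ 2 * inner ℝ p.2 y ^ 2) +
        4 * (inner ℝ p.1 w ^ 1 * inner ℝ p.2 y ^ 3) +
        inner ℝ p.1 w ^ 0 * inner ℝ p.2 y ^ 4 :=
    fun p => by ring
  have s20 := ((hm 2 0).add ((hm 1 1).const_mul 2))
  have s43 := (hm 4 0).add ((hm 3 1).const_mul 4)
  have s42 := s43.add ((hm 2 2).const_mul 6)
  have s41 := s42.add ((hm 1 3).const_mul 4)
  simp only [Pi.add_def] at s20 s43 s42 s41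
  refine measure_abs_lt_le_of_moments (v := ‖w‖ ^ 2 / d + V) ?_ ?_ ?_ ?_ ?_
  · simp_rw [e2]
    exact s20.add (hm 0 2)
  · simp_rw [e4]
    exact s41.add (hm 0 4)
  · simp_rw [e2]
    rw [integral_add s20 (hm 0 2), integral_add (hm 2 0) ((hm 1 1).const_mul 2),
      integral_const_mul, hmi, hmi, hmi, g1', g2, a2]
    simp
  · simp_rw [e4]
    rw [integral_add s41 (hm 0 4), integral_add s42 ((hm 1 3).const_mul 4),
      integral_add s43 ((hm 2 2).const_mul 6), integral_add (hm 4 0) ((hm 3 1).const_mul 4),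
      integral_const_mul, integral_const_mul, integral_const_mul, hmi, hmi, hmi, hmi, hmi, g1', g2,
      g3, g4, a2]
    simp only [pow_zero, integral_const, probReal_univ, smul_eq_mul, mul_one, mul_zero,
      add_zero, one_mul]
    nlinarith [a4]
  · refine ht.trans (mul_le_mul_of_nonneg_left ?_ (by norm_num))
    refine Real.le_sqrt_of_sq_le ?_
    rw [div_pow, Real.sq_sqrt (by positivity)]
    have : (0 : ℝ) ≤ V := V.2
    linarith

open Classical in
/-- A lower tail bound for the number of `j ∈ J` for which `X i` and `X j` are related. -/
theorem measure_card_filter_lt_le {Ω ι E : Type*} [MeasurableSpace Ω] [MeasurableSpace E]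
    {μ : Measure Ω} [IsProbabilityMeasure μ] {X : ι → Ω → E} (hX : ∀ i, AEMeasurable (X i) μ)
    (hind : iIndepFun X μ) {i : ι} {J : Finset ι} (hi : i ∉ J) {A : Set (E × E)}
    (hA : MeasurableSet A)
    (hsmall : ∀ y, ∀ j ∈ J, (μ.map (X j)) {z | (y, z) ∉ A} ≤ ENNReal.ofReal (3 / 4))
    {q : ℕ} (hq : 5 * q ≤ J.card) :
    μ {ω | (J.filter fun j => (X i ω, X j ω) ∈ A).card < q} ≤
      ENNReal.ofReal (Real.exp (-(1 / 1000 * J.card))) := by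
  set g : E × E → ℝ≥0∞ := fun p => ENNReal.ofReal (Real.exp (-(1 / 10) * A.indicator 1 p))
  have hAi : Measurable (A.indicator (1 : E × E → ℝ)) := measurable_one.indicator hA
  have hg : Measurable g := by fun_prop
  have hcount : ∀ ω, ((J.filter fun j => (X i ω, X j ω) ∈ A).card : ℝ) =
      ∑ j ∈ J, A.indicator 1 (X i ω, X j ω) := by
    intro ω
    rw [Finset.card_filter]
    push_cast
    exact Finset.sum_congr rfl fun j _ => by simp [Set.indicator_apply]
  have hmeas : AEMeasurable (fun ω => -∑ j ∈ J, A.indicator (1 : E × E → ℝ) (X i ω, X j ω)) μ :=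
    (Finset.aemeasurable_fun_sum _ fun j _ =>
      hAi.comp_aemeasurable ((hX i).prodMk (hX j))).neg
  have h1 := measure_le_exp_mul_lintegral hmeas (l := 1 / 10) (by norm_num) (-q : ℝ)
  have hexp : ∀ ω, ENNReal.ofReal (Real.exp (1 / 10 *
      -∑ j ∈ J, A.indicator (1 : E × E → ℝ) (X i ω, X j ω))) =
      ∏ j : J, g (X i ω, X j ω) := by
    intro ω
    rw [Finset.prod_coe_sort J (fun j => g (X i ω, X j ω)),
      ← ENNReal.ofReal_prod_of_nonneg (fun j _ => (Real.exp_pos _).le), ← Real.exp_sum,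
      ← Finset.mul_sum]
    congr 2; ring
  simp_rw [hexp] at h1
  -- Since `i ∉ J`, the value of `X i` can be frozen, after which the factors over `J` are
  -- independent.
  have hindJ : IndepFun (X i) (fun ω (j : J) => X j ω) μ :=
    (hind.indepFun_finset₀ {i} J (by simpa using hi) hX).comp
      (φ := fun x : ({i} : Finset ι) → E => x ⟨i, by simp⟩) (ψ := fun x : J → E => x)
      (measurable_pi_apply (⟨i, by simp⟩ : ({i} : Finset ι))) measurable_id
  have hJ : iIndepFun (fun j : J => X j) μ := hind.precomp Subtype.val_injective
  have hmapJ := iIndepFun.map_fun_eq_pi_map (fun j : J => hX j) hJ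
  have hmJ : AEMeasurable (fun ω (j : J) => X j ω) μ := aemeasurable_pi_lambda _ fun j => hX j
  have hmap := hindJ.map_prod_eq_prod_map_map (hX i) hmJ
  have hgp : Measurable fun p : E × (J → E) => ∏ j : J, g (p.1, p.2 j) := by fun_prop
  have : ∀ j, IsProbabilityMeasure (μ.map (X j)) :=
    fun j => Measure.isProbabilityMeasure_map (hX j)
  have hr : Real.exp (-(1 / 10)) ≤ 10 / 11 := by
    rw [Real.exp_neg, inv_le_comm₀ (Real.exp_pos _) (by norm_num)]
    have := Real.add_one_le_exp (1 / 10 : ℝ)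
    norm_num at this ⊢
    linarith
  -- Each factor has mean at most `10/11 + 1/11 * 3/4 = 43/44 ≤ exp(-1/44)`.
  have hone : ∀ y, ∀ j : J, ∫⁻ z, g (y, z) ∂(μ.map (X j)) ≤
      ENNReal.ofReal (Real.exp (-(1 / 44))) := by
    intro y j
    have hAc : MeasurableSet {z | (y, z) ∉ A} := (hA.preimage measurable_prodMk_left).compl
    have h3 : ∀ z, g (y, z) ≤ ENNReal.ofReal (10 / 11) +
        {z | (y, z) ∉ A}.indicator (fun _ => ENNReal.ofReal (1 / 11)) z := by
      intro z
      by_cases hz : (y, z) ∈ A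
      · have : z ∉ {z | (y, z) ∉ A} := by simpa using hz
        rw [Set.indicator_of_notMem this]
        simp only [g, Set.indicator_of_mem hz, Pi.one_apply, mul_one, add_zero]
        exact ENNReal.ofReal_le_ofReal hr
      · have : z ∈ {z | (y, z) ∉ A} := by simpa using hz
        rw [Set.indicator_of_mem this, ← ENNReal.ofReal_add (by norm_num) (by norm_num)]
        simp only [g, Set.indicator_of_notMem hz, mul_zero, Real.exp_zero]
        norm_num
    calc _ ≤ _ := lintegral_mono h3
      _ = ENNReal.ofReal (10 / 11) + ENNReal.ofReal (1 / 11) * (μ.map (X j)) {z | (y, z) ∉ A} := by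
        rw [lintegral_add_left measurable_const, lintegral_const, measure_univ, mul_one,
          lintegral_indicator_const hAc]
      _ ≤ ENNReal.ofReal (10 / 11) + ENNReal.ofReal (1 / 11) * ENNReal.ofReal (3 / 4) := by
        gcongr; exact hsmall y j j.2
      _ ≤ _ := by
        rw [← ENNReal.ofReal_mul (by norm_num), ← ENNReal.ofReal_add (by norm_num) (by norm_num)]
        refine ENNReal.ofReal_le_ofReal ?_
        have := Real.add_one_le_exp (-(1 / 44) : ℝ)
        norm_num at this ⊢
        linarith
  have hprod : ∫⁻ ω, ∏ j : J, g (X i ω, X j ω) ∂μ ≤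
      ENNReal.ofReal (Real.exp (-(1 / 44))) ^ J.card := by
    rw [← lintegral_map' (f := fun p : E × (J → E) => ∏ j : J, g (p.1, p.2 j))
      (g := fun ω => (X i ω, fun j : J => X j ω)) hgp.aemeasurable ((hX i).prodMk hmJ),
      hmap, hmapJ, lintegral_prod _ hgp.aemeasurable]
    have := Measure.isProbabilityMeasure_map (μ := μ) (hX i)
    calc _ ≤ ∫⁻ y, ENNReal.ofReal (Real.exp (-(1 / 44))) ^ J.card ∂(μ.map (X i)) := by
          refine lintegral_mono fun y => ?_
          simp only
          rw [lintegral_pi_prod_eq_prod (fun j : J => μ.map (X j)) (fun j z => g (y, z))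
            fun j => by fun_prop]
          refine (Finset.prod_le_prod' fun j _ => hone y j).trans (by simp)
      _ = _ := by simp
  calc _ ≤ μ {ω | (-q : ℝ) ≤ -∑ j ∈ J, A.indicator (1 : E × E → ℝ) (X i ω, X j ω)} := by
        refine measure_mono (Set.ofPred_subset_ofPred.2 fun ω hω => ?_)
        rw [← hcount]
        have : ((J.filter fun j => (X i ω, X j ω) ∈ A).card : ℝ) ≤ q := by exact_mod_cast hω.le
        linarith
    _ ≤ ENNReal.ofReal (Real.exp (-(1 / 10 * (-q)))) *
        ENNReal.ofReal (Real.exp (-(1 / 44))) ^ J.card := h1.trans (by gcongr)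
    _ ≤ _ := by
        rw [← ENNReal.ofReal_pow (Real.exp_pos _).le, ← Real.exp_nat_mul,
          ← ENNReal.ofReal_mul (Real.exp_pos _).le, ← Real.exp_add]
        refine ENNReal.ofReal_le_ofReal (Real.exp_le_exp.2 ?_)
        -- With `q ≤ |J|/5` the exponent is at most `(1/50 - 1/44)|J|`, which is below `-|J|/1000`.
        have : (5 : ℝ) * q ≤ J.card := by exact_mod_cast hq
        linarith

/-! ### Independence -/

/-- The joint law of both families is a product of two product measures; transposing the factors
makes it a product over the index. This yields independence of the points from that of signals and
noises. -/
theorem iIndepFun_prodMk_of_indepFun {Ω ι E F : Type*} [Fintype ι] [MeasurableSpace Ω]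
    [MeasurableSpace E] [MeasurableSpace F] {μ : Measure Ω} [IsProbabilityMeasure μ]
    {b : ι → Ω → E} {e : ι → Ω → F} (hb : ∀ i, AEMeasurable (b i) μ)
    (he : ∀ i, AEMeasurable (e i) μ) (hbi : iIndepFun b μ) (hei : iIndepFun e μ)
    (hbe : IndepFun (fun ω i => b i ω) (fun ω i => e i ω) μ) :
    iIndepFun (fun i ω => (b i ω, e i ω)) μ := by
  have hbv : AEMeasurable (fun ω i => b i ω) μ := aemeasurable_pi_lambda _ hb
  have hev : AEMeasurable (fun ω i => e i ω) μ := aemeasurable_pi_lambda _ he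
  have : ∀ i, IsProbabilityMeasure (μ.map (b i)) := fun i => Measure.isProbabilityMeasure_map (hb i)
  have : ∀ i, IsProbabilityMeasure (μ.map (e i)) := fun i => Measure.isProbabilityMeasure_map (he i)
  rw [iIndepFun_iff_map_fun_eq_pi_map fun i => (hb i).prodMk (he i)]
  have h1 : ∀ i, μ.map (fun ω => (b i ω, e i ω)) = (μ.map (b i)).prod (μ.map (e i)) := fun i =>
    (hbe.comp (measurable_pi_apply i) (measurable_pi_apply i)).map_prod_eq_prod_map_map (hb i) (he i)
  simp_rw [h1]
  have hmp := measurePreserving_arrowProdEquivProdArrow E F ι (fun i => μ.map (b i))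
    (fun i => μ.map (e i))
  have h2 := hbe.map_prod_eq_prod_map_map hbv hev
  rw [iIndepFun.map_fun_eq_pi_map hb hbi, iIndepFun.map_fun_eq_pi_map he hei] at h2
  rw [← hmp.symm.map_eq, ← h2, AEMeasurable.map_map_of_aemeasurable
    (MeasurableEquiv.measurable _).aemeasurable (hbv.prodMk hev)]
  rfl

/-- Conditioning on `X`, by Fubini: fixed-vector tail bounds carry over to random vectors
independent of the noise. -/
theorem measure_le_of_indepFun {Ω E F : Type*} [MeasurableSpace Ω] [MeasurableSpace E]
    [MeasurableSpace F] {μ : Measure Ω} [IsProbabilityMeasure μ] {X : Ω → E} {Y : Ω → F}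
    (hX : AEMeasurable X μ) (hY : AEMeasurable Y μ) (h : IndepFun X Y μ) {S : Set (E × F)}
    (hS : MeasurableSet S) {C : ℝ≥0∞}
    (hC : ∀ᵐ ω ∂μ, (μ.map Y) {y | (X ω, y) ∈ S} ≤ C) : μ {ω | (X ω, Y ω) ∈ S} ≤ C := by
  have := Measure.isProbabilityMeasure_map hX
  have := Measure.isProbabilityMeasure_map hY
  have h1 : μ {ω | (X ω, Y ω) ∈ S} = (μ.map (fun ω => (X ω, Y ω))) S :=
    (Measure.map_apply_of_aemeasurable (hX.prodMk hY) hS).symm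
  rw [h1, h.map_prod_eq_prod_map_map hX hY, Measure.prod_apply hS,
    lintegral_map' (measurable_measure_prodMk_left hS).aemeasurable hX]
  calc _ ≤ ∫⁻ _, C ∂μ := lintegral_mono_ae hC
    _ = C := by simp

/-! ### Tail bounds for the random points -/

section Points

variable {Ω : Type*} [MeasurableSpace Ω] {μ : Measure Ω} [IsProbabilityMeasure μ]

theorem inner_toEuclideanLin_right {m d : ℕ} (U : Matrix (Fin m) (Fin d) ℝ)
    (a : EuclideanSpace ℝ (Fin d)) (y : EuclideanSpace ℝ (Fin m)) :
    inner ℝ (U.toEuclideanLin a) y = inner ℝ a (U.transpose.toEuclideanLin y) := by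
  rw [← Matrix.conjTranspose_eq_transpose_of_trivial, Matrix.toEuclideanLin_conjTranspose_eq_adjoint,
    LinearMap.adjoint_inner_right]

theorem toEuclideanLin_mul {m d d' : ℕ} (U : Matrix (Fin m) (Fin d) ℝ)
    (V : Matrix (Fin d) (Fin d') ℝ) (b : EuclideanSpace ℝ (Fin d')) :
    (U * V).toEuclideanLin b = U.toEuclideanLin (V.toEuclideanLin b) := by
  simp [Matrix.toLpLin_apply]

theorem norm_toEuclideanLin_of_orthonormal {m d : ℕ} {U : Matrix (Fin m) (Fin d) ℝ}
    (hU : U.transpose * U = 1) (a : EuclideanSpace ℝ (Fin d)) : ‖U.toEuclideanLin a‖ = ‖a‖ := by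
  have h : inner ℝ (U.toEuclideanLin a) (U.toEuclideanLin a) = inner ℝ a a := by
    rw [inner_toEuclideanLin_right, ← toEuclideanLin_mul, hU]
    simp
  rw [real_inner_self_eq_norm_sq, real_inner_self_eq_norm_sq] at h
  exact (sq_eq_sq₀ (norm_nonneg _) (norm_nonneg _)).1 h

theorem measurable_toEuclideanLin {m d : ℕ} (U : Matrix (Fin m) (Fin d) ℝ) :
    Measurable U.toEuclideanLin :=
  (LinearMap.continuous_of_finiteDimensional _).measurable

theorem measure_inner_signals_le {m d d' : ℕ} (hd : 1 ≤ d) (hd' : 1 ≤ d')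
    (U : Matrix (Fin m) (Fin d) ℝ) (V : Matrix (Fin m) (Fin d') ℝ)
    {a : Ω → EuclideanSpace ℝ (Fin d)} {b : Ω → EuclideanSpace ℝ (Fin d')}
    (ha : HasLaw a (uniformSphere d) μ) (hb : HasLaw b (uniformSphere d') μ)
    (hab : IndepFun a b μ) (K : ℝ) :
    μ {ω | K * (frobenius (U.transpose * V) / (Real.sqrt d * Real.sqrt d')) <
      |inner ℝ (U.toEuclideanLin (a ω)) (V.toEuclideanLin (b ω))|} ≤
      ENNReal.ofReal (8 / 3 * Real.exp (-(5 / 8 * K))) := by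
  have := isProbabilityMeasure_uniformSphere hd
  have := isProbabilityMeasure_uniformSphere hd'
  have hlaw := hab.hasLaw_prod ha hb
  have hm := measurable_toEuclideanLin (U.transpose * V)
  have h := uniformSphere_prod_bilinear_le hd hd' (U.transpose * V) K
  rw [← hlaw.measure_eq (measurableSet_lt (by fun_prop) (by fun_prop))] at h
  simp_rw [toEuclideanLin_mul, ← inner_toEuclideanLin_right] at h
  exact h

theorem measure_inner_signal_noise_le {m : ℕ} {σ l : ℝ} (hm : 0 < m) (hσ : 0 ≤ σ) (hl : 0 < l)
    {u e : Ω → EuclideanSpace ℝ (Fin m)} (hu : AEMeasurable u μ) (hu1 : ∀ᵐ ω ∂μ, ‖u ω‖ = 1)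
    (he : HasLaw e (noiseLaw m σ) μ) (hue : IndepFun u e μ) :
    μ {ω | inner ℝ (e ω) (u ω) < -(2 * (σ * Real.sqrt (l / m)))} ≤
      ENNReal.ofReal (Real.exp (-(2 * l))) := by
  refine measure_le_of_indepFun hu he.aemeasurable hue
    (S := {p | inner ℝ p.2 p.1 < -(2 * (σ * Real.sqrt (l / m)))})
    (measurableSet_lt (by fun_prop) (by fun_prop)) ?_
  filter_upwards [hu1] with ω hω
  rw [he.map_eq]
  exact noiseLaw_inner_lt_neg_le hm hσ hl hω

theorem measure_inner_mixed_le {m : ℕ} {σ l : ℝ} (hm : 0 < m) (hσ : 0 ≤ σ) (hl : 0 < l)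
    {u v e f : Ω → EuclideanSpace ℝ (Fin m)} (hu : AEMeasurable u μ) (hv : AEMeasurable v μ)
    (hu1 : ∀ᵐ ω ∂μ, ‖u ω‖ = 1) (hv1 : ∀ᵐ ω ∂μ, ‖v ω‖ = 1)
    (he : HasLaw e (noiseLaw m σ) μ) (hf : HasLaw f (noiseLaw m σ) μ) (hef : IndepFun e f μ)
    (hind : IndepFun (fun ω => (u ω, v ω)) (fun ω => (e ω, f ω)) μ) :
    μ {ω | 4 * (σ * Real.sqrt (l / m)) < |inner ℝ (e ω) (u ω) + inner ℝ (f ω) (v ω)|} ≤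
      ENNReal.ofReal (2 * Real.exp (-(4 * l))) := by
  refine measure_le_of_indepFun (hu.prodMk hv) (he.aemeasurable.prodMk hf.aemeasurable) hind
    (S := {p | 4 * (σ * Real.sqrt (l / m)) < |inner ℝ p.2.1 p.1.1 + inner ℝ p.2.2 p.1.2|})
    (measurableSet_lt (by fun_prop) (by fun_prop)) ?_
  filter_upwards [hu1, hv1] with ω hω hω'
  rw [(hef.hasLaw_prod he hf).map_eq]
  exact noiseLaw_prod_inner_add_inner_le hm hσ hl hω hω'

theorem measure_inner_noises_le {m : ℕ} {σ l : ℝ} (hm : 0 < m) (hσ : 0 ≤ σ) (hl : 0 < l)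
    (hml : 6 * l ≤ m) {e f : Ω → EuclideanSpace ℝ (Fin m)}
    (he : HasLaw e (noiseLaw m σ) μ) (hf : HasLaw f (noiseLaw m σ) μ) (hef : IndepFun e f μ) :
    μ {ω | 24 / 5 * (σ ^ 2 * Real.sqrt (l / m)) < |inner ℝ (e ω) (f ω)|} ≤
      ENNReal.ofReal (2 * Real.exp (-(4 * l))) := by
  have h := noiseLaw_prod_inner_le hm hσ hl hml
  rwa [← (hef.hasLaw_prod he hf).measure_eq (measurableSet_lt (by fun_prop) (by fun_prop))] at h

theorem map_signal_add_noise_small_ball {m d : ℕ} (hd : 1 ≤ d) {σ : ℝ}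
    (U : Matrix (Fin m) (Fin d) ℝ) {a : Ω → EuclideanSpace ℝ (Fin d)}
    {e : Ω → EuclideanSpace ℝ (Fin m)} (ha : HasLaw a (uniformSphere d) μ)
    (he : HasLaw e (noiseLaw m σ) μ) (hae : IndepFun a e μ) (y : EuclideanSpace ℝ (Fin m)) :
    (μ.map (fun ω => U.toEuclideanLin (a ω) + e ω))
      {z | ¬ 5 / 12 * (‖U.transpose.toEuclideanLin y‖ / Real.sqrt d) ≤ |inner ℝ y z|} ≤
      ENNReal.ofReal (3 / 4) := by
  have := isProbabilityMeasure_uniformSphere hd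
  have hU := measurable_toEuclideanLin U
  have ha' := ha.aemeasurable
  have he' := he.aemeasurable
  have h := uniformSphere_prod_noiseLaw_small_ball hd σ (U.transpose.toEuclideanLin y) y le_rfl
  rw [← (hae.hasLaw_prod ha he).measure_eq (measurableSet_lt (by fun_prop) (by fun_prop))] at h
  have hx : AEMeasurable (fun ω => U.toEuclideanLin (a ω) + e ω) μ :=
    (hU.comp_aemeasurable ha').add he'
  simp_rw [not_le]
  rw [Measure.map_apply_of_aemeasurable hx]
  · refine le_trans (le_of_eq ?_) h
    congr 1
    ext ω
    simp only [Set.mem_preimage, Set.mem_ofPred_eq, ← inner_toEuclideanLin_right,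
      real_inner_comm, inner_add_right]
  · exact measurableSet_lt (by fun_prop) (by fun_prop)

end Points

/-! ### Detection from separated inner products -/

/-- If a selected point fell below the threshold, maximality would force all of `G` into the
remaining `q - 1` selected points. So every selected inner product is at least `τ`, which excludes
other clusters and, as `τ > 0`, makes the edge nonzero. -/
theorem subspaceDetection_of_separated {ι κ : Type*} [Fintype ι] [DecidableEq ι] {m q : ℕ}
    {x : ι → EuclideanSpace ℝ (Fin m)} {label : ι → κ} {τ : ι → ℝ} (hτ : ∀ i, 0 < τ i)
    (hin : ∀ i, ∃ G : Finset ι, q ≤ G.card ∧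
      ∀ j ∈ G, j ≠ i ∧ τ i ≤ |inner ℝ (x i) (x j)|)
    (hout : ∀ i p, label p ≠ label i → |inner ℝ (x i) (x p)| < τ i)
    {S : ι → Finset ι} (hS : ∀ j, IsNeighborSet q x j (S j)) :
    SubspaceDetection q label (adjacency x S) := by
  have hlarge : ∀ j, ∀ i ∈ S j, τ j ≤ |inner ℝ (x j) (x i)| := by
    intro j i hi
    obtain ⟨hcard, hj, hmax⟩ := hS j
    obtain ⟨G, hGq, hG⟩ := hin j
    by_contra hlt
    have hiG : i ∉ G := fun h => hlt (hG i h).2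
    have hGS : G ⊆ (S j).erase i := by
      intro p hp
      refine Finset.mem_erase.2 ⟨fun h => hiG (h ▸ hp), ?_⟩
      by_contra hpS
      exact hlt ((hG p hp).2.trans (hmax i hi p (hG p hp).1 hpS))
    have h1 := Finset.card_le_card hGS
    have h2 := Finset.card_erase_lt_of_mem hi
    omega
  have hlab : ∀ j, ∀ i ∈ S j, label i = label j := by
    intro j i hi
    by_contra h
    exact absurd (hlarge j i hi) (not_le.2 (hout j i h))
  refine ⟨fun i j hA => ?_, fun i => ?_⟩
  · by_cases h1 : i ∈ S j
    · exact hlab j i h1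
    by_cases h2 : j ∈ S i
    · exact (hlab i j h2).symm
    · exact absurd (by simp [adjacency, coeffVec, h1, h2]) hA
  · have hsub : ∀ j ∈ S i, label j = label i ∧ adjacency x S i j ≠ 0 := by
      intro j hj
      refine ⟨hlab i j hj, ?_⟩
      have h1 : 0 < |inner ℝ (x i) (x j)| := (hτ i).trans_le (hlarge i j hj)
      simp only [adjacency, coeffVec, if_pos hj, abs_abs]
      positivity
    calc q = Nat.card (S i) := by rw [Nat.card_eq_fintype_card, Fintype.card_coe, (hS i).1]
      _ ≤ _ := Nat.card_le_card_of_injective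
        (fun j : S i => (⟨j.1, hsub j.1 j.2⟩ : {j // label j = label i ∧ adjacency x S i j ≠ 0}))
        fun j k h => Subtype.ext (congrArg (fun t => t.1) h)

/-! ### The clustering condition -/

/-- The factor `1/√d'` is retained because the threshold of a point scales with its own dimension.
-/
theorem frobenius_div_le_affinity {m d d' : ℕ} (hd : 1 ≤ d) (hd' : 1 ≤ d')
    (U : Matrix (Fin m) (Fin d) ℝ) (V : Matrix (Fin m) (Fin d') ℝ) :
    frobenius (U.transpose * V) / (Real.sqrt d * Real.sqrt d') ≤ affinity U V / Real.sqrt d' := by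
  have h0 : (0 : ℝ) < d := by exact_mod_cast hd
  have h0' : (0 : ℝ) < d' := by exact_mod_cast hd'
  have h1 : (0 : ℝ) < (min d d' : ℕ) := by exact_mod_cast lt_min hd hd'
  have h2 : Real.sqrt (min d d' : ℕ) ≤ Real.sqrt d :=
    Real.sqrt_le_sqrt (by exact_mod_cast min_le_left d d')
  have h3 : 0 < Real.sqrt (min d d' : ℕ) := Real.sqrt_pos.2 h1
  have hF : 0 ≤ frobenius (U.transpose * V) := Real.sqrt_nonneg _
  rw [← div_div]
  gcongr
  rw [affinity, ← frobenius, one_div_mul_eq_div]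
  gcongr

theorem affinity_le_maxAffinity {L m : ℕ} {d : Fin L → ℕ}
    (U : (l : Fin L) → Matrix (Fin m) (Fin (d l)) ℝ) {k l : Fin L} (hkl : k ≠ l) :
    affinity (U k) (U l) ≤ maxAffinity U :=
  le_ciSup (f := fun p : {p : Fin L × Fin L // p.1 ≠ p.2} => affinity (U p.1.1) (U p.1.2))
    (Set.finite_range _).bddAbove ⟨(k, l), hkl⟩

theorem maxAffinity_nonneg {L m : ℕ} {d : Fin L → ℕ}
    (U : (l : Fin L) → Matrix (Fin m) (Fin (d l)) ℝ) : 0 ≤ maxAffinity U :=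
  Real.iSup_nonneg fun _ => mul_nonneg (by positivity) (Real.sqrt_nonneg _)

/-- The clustering condition, multiplied by `log N`. -/
theorem clustering_condition_mul {A σ l D m : ℝ} (hl : 0 < l) (hm : 0 < m)
    (h : A + σ * (1 + σ) / Real.sqrt l * (D / Real.sqrt m) ≤ 1 / (12 * l)) :
    l * A + (σ * Real.sqrt (l / m) + σ ^ 2 * Real.sqrt (l / m)) * D ≤ 1 / 12 := by
  have h1 := mul_le_mul_of_nonneg_left h hl.le
  have hsl : 0 < Real.sqrt l := Real.sqrt_pos.2 hl
  have hsm : 0 < Real.sqrt m := Real.sqrt_pos.2 hm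
  have h2 : l * (1 / (12 * l)) = 1 / 12 := by field_simp
  have h3 : l * (σ * (1 + σ) / Real.sqrt l * (D / Real.sqrt m)) =
      (σ * Real.sqrt (l / m) + σ ^ 2 * Real.sqrt (l / m)) * D := by
    rw [Real.sqrt_div hl.le]
    nth_rewrite 1 [← Real.mul_self_sqrt hl.le]
    field_simp
  rw [mul_add, h2, h3] at h1
  exact h1

theorem noise_level_le {A η ξ l D : ℝ} (hA : 0 ≤ A) (hl : 0 < l) (hη : 0 ≤ η) (hξ : 0 ≤ ξ)
    (hD : 1 ≤ D) (h : l * A + (η + ξ) * D ≤ 1 / 12) : η ≤ 1 / 12 := by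
  have h1 : 0 ≤ l * A := by positivity
  nlinarith [mul_nonneg (add_nonneg hη hξ) (sub_nonneg.2 hD)]

/-- After multiplication by `s`, and with `η ≤ ηs`, the worst coefficient is `4 + 5/6 = 29/6`, and
`29/6 * 1/12 = 29/72 < 30/72 = 5/12`. -/
theorem separation {A a F η ξ l D s : ℝ} (hA : a ≤ A) (hA0 : 0 ≤ A) (hF : F ≤ a / s) (hl : 0 < l)
    (hη : 0 ≤ η) (hξ : 0 ≤ ξ) (hs : 1 ≤ s) (hsD : s ≤ D)
    (h : l * A + (η + ξ) * D ≤ 1 / 12) :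
    24 / 5 * l * F + 4 * η + 24 / 5 * ξ < 5 / 12 * ((1 - 2 * η) / s) := by
  have hs0 : 0 < s := by linarith
  have h1 : F * s ≤ A := by rw [le_div_iff₀ hs0] at hF; linarith
  rw [← mul_div_assoc, lt_div_iff₀ hs0]
  have h2 : l * (F * s) ≤ l * A := mul_le_mul_of_nonneg_left h1 hl.le
  have h3 : η * s ≤ η * D := mul_le_mul_of_nonneg_left hsD hη
  have h4 : ξ * s ≤ ξ * D := mul_le_mul_of_nonneg_left hsD hξ
  have h5 : η * 1 ≤ η * s := mul_le_mul_of_nonneg_left hs hη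
  have h6 : 0 ≤ l * A := by positivity
  have h7 : 0 ≤ ξ * D := by nlinarith
  nlinarith

/-! ### The random event on which detection holds -/

theorem indepFun_pi_comp_left {Ω ι : Type*} [MeasurableSpace Ω] {μ : Measure Ω}
    {E F G : ι → Type*} [∀ i, MeasurableSpace (E i)] [∀ i, MeasurableSpace (F i)]
    [∀ i, MeasurableSpace (G i)] {a : (i : ι) → Ω → E i} {e : (i : ι) → Ω → F i}
    {T : (i : ι) → E i → G i} (h : IndepFun (fun ω i => a i ω) (fun ω i => e i ω) μ)
    (hT : ∀ i, Measurable (T i)) :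
    IndepFun (fun ω i => T i (a i ω)) (fun ω i => e i ω) μ :=
  h.comp (φ := fun (v : (i : ι) → E i) i => T i (v i)) (ψ := fun v : (i : ι) → F i => v)
    (measurable_pi_lambda _ fun i => (hT i).comp (measurable_pi_apply i)) measurable_id

theorem measure_not_forall_le {Ω ι : Type*} [MeasurableSpace Ω] [Fintype ι] {μ : Measure Ω}
    (P : ι → Ω → Prop) : μ {ω | ¬ ∀ i, P i ω} ≤ ∑ i, μ {ω | ¬ P i ω} := by
  have h : {ω | ¬ ∀ i, P i ω} = ⋃ i, {ω | ¬ P i ω} := by ext; simp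
  rw [h]
  exact measure_iUnion_fintype_le _ _

theorem measure_compl_le_sum {Ω ι : Type*} [MeasurableSpace Ω] [Fintype ι] {μ : Measure Ω}
    {P : ι → Ω → Prop} {s : Set Ω} {f : ι → ℝ≥0∞} (hs : ∀ ω, (∀ i, P i ω) → ω ∈ s)
    (hf : ∀ i, μ {ω | ¬ P i ω} ≤ f i) : μ sᶜ ≤ ∑ i, f i := by
  refine le_trans (measure_mono ?_) ((measure_not_forall_le P).trans
    (Finset.sum_le_sum fun i _ => hf i))
  intro ω hω h
  exact hω (hs ω h)

theorem measure_not_and_le {Ω : Type*} [MeasurableSpace Ω] {μ : Measure Ω}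
    (P Q : Ω → Prop) : μ {ω | ¬ (P ω ∧ Q ω)} ≤ μ {ω | ¬ P ω} + μ {ω | ¬ Q ω} := by
  refine (measure_mono ?_).trans (measure_union_le _ _)
  intro ω hω
  simp only [Set.mem_ofPred_eq, not_and_or] at hω
  simpa using hω

/-- Subadditivity suffices, so the event need not be measurable. -/
theorem one_sub_le_measureReal {Ω : Type*} [MeasurableSpace Ω] {μ : Measure Ω}
    [IsProbabilityMeasure μ] {s : Set Ω} {r : ℝ} (hr : 0 ≤ r) (h : μ sᶜ ≤ ENNReal.ofReal r) :
    1 - r ≤ μ.real s := by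
  have h1 : (1 : ENNReal) ≤ μ s + μ sᶜ := by
    rw [← measure_univ (μ := μ), ← Set.union_compl_self s]
    exact measure_union_le _ _
  have h2 := ENNReal.toReal_mono (by finiteness) (h1.trans (add_le_add_right h _))
  rw [ENNReal.toReal_add (by finiteness) (by finiteness),
    ENNReal.toReal_ofReal hr, ENNReal.toReal_one] at h2
  rw [measureReal_def]
  linarith

theorem card_same_label {L : ℕ} (n : Fin L → ℕ) (i : Σ l : Fin L, Fin (n l)) :
    (Finset.univ.filter fun j : Σ l : Fin L, Fin (n l) => j ≠ i ∧ j.1 = i.1).card = n i.1 - 1 := by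
  have h : (Finset.univ.filter fun j : Σ l : Fin L, Fin (n l) => j ≠ i ∧ j.1 = i.1) =
      ((Finset.univ : Finset (Fin (n i.1))).map (Function.Embedding.sigmaMk i.1)).erase i := by
    ext ⟨l, j⟩
    simp only [Finset.mem_filter, Finset.mem_univ, true_and, Finset.mem_erase, Finset.mem_map,
      Function.Embedding.sigmaMk_apply]
    refine and_congr_right fun _ => ⟨?_, ?_⟩
    · rintro rfl
      exact ⟨j, rfl⟩
    · rintro ⟨j', hj'⟩
      exact (congrArg Sigma.fst hj').symm
  have hi : i ∈ (Finset.univ : Finset (Fin (n i.1))).map (Function.Embedding.sigmaMk i.1) :=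
    Finset.mem_map.2 ⟨i.2, Finset.mem_univ _, rfl⟩
  rw [h, Finset.card_erase_of_mem hi]
  simp

theorem subspaceDetection_of_bounds {L m q : ℕ} {n d : Fin L → ℕ}
    {U : (l : Fin L) → Matrix (Fin m) (Fin (d l)) ℝ} (hd : ∀ k, 1 ≤ d k)
    (hU : ∀ k, (U k).transpose * U k = 1) {A η ξ l D : ℝ} (hA0 : 0 ≤ A)
    (hA : ∀ k k', k ≠ k' → affinity (U k) (U k') ≤ A) (hl : 0 < l) (hη : 0 ≤ η) (hξ : 0 ≤ ξ)
    (hs1 : ∀ k, 1 ≤ Real.sqrt (d k)) (hsD : ∀ k, Real.sqrt (d k) ≤ D)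
    (hcond : l * A + (η + ξ) * D ≤ 1 / 12)
    {a : (i : Σ l : Fin L, Fin (n l)) → EuclideanSpace ℝ (Fin (d i.1))}
    {e x : (Σ l : Fin L, Fin (n l)) → EuclideanSpace ℝ (Fin m)}
    (hx : ∀ i, x i = (U i.1).toEuclideanLin (a i) + e i) (ha : ∀ i, ‖a i‖ = 1)
    (hg : ∀ i, -(2 * η) ≤ inner ℝ (e i) ((U i.1).toEuclideanLin (a i)))
    (hin : ∀ i, ∃ G : Finset (Σ l : Fin L, Fin (n l)), q ≤ G.card ∧ ∀ j ∈ G, j ≠ i ∧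
      5 / 12 * (‖(U i.1).transpose.toEuclideanLin (x i)‖ / Real.sqrt (d i.1)) ≤
        |inner ℝ (x i) (x j)|)
    (h1 : ∀ i p : Σ l : Fin L, Fin (n l), p.1 ≠ i.1 →
      |inner ℝ ((U p.1).toEuclideanLin (a p)) ((U i.1).toEuclideanLin (a i))| ≤
        24 / 5 * l * (frobenius ((U p.1).transpose * U i.1) /
          (Real.sqrt (d p.1) * Real.sqrt (d i.1))))
    (h2 : ∀ i p : Σ l : Fin L, Fin (n l), p.1 ≠ i.1 →
      |inner ℝ (e i) ((U p.1).toEuclideanLin (a p)) +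
        inner ℝ (e p) ((U i.1).toEuclideanLin (a i))| ≤ 4 * η)
    (h3 : ∀ i p : Σ l : Fin L, Fin (n l), p.1 ≠ i.1 → |inner ℝ (e p) (e i)| ≤ 24 / 5 * ξ)
    {S : (Σ l : Fin L, Fin (n l)) → Finset (Σ l : Fin L, Fin (n l))}
    (hS : ∀ j, IsNeighborSet q x j (S j)) :
    SubspaceDetection q (fun i : Σ l : Fin L, Fin (n l) => i.1) (adjacency x S) := by
  refine subspaceDetection_of_separated
    (τ := fun i => 5 / 12 * ((1 - 2 * η) / Real.sqrt (d i.1))) (fun i => ?_) (fun i => ?_)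
    (fun i p hp => ?_) hS
  · have := noise_level_le hA0 hl hη hξ ((hs1 i.1).trans (hsD i.1)) hcond
    have := hs1 i.1
    have : 0 < 1 - 2 * η := by linarith
    positivity
  · obtain ⟨G, hcard, hG⟩ := hin i
    refine ⟨G, hcard, fun j hj => ⟨(hG j hj).1, le_trans ?_ (hG j hj).2⟩⟩
    -- Cauchy–Schwarz against the unit vector `a i`: `‖Uᵀx‖ ≥ ⟨Ua, x⟩ = 1 + ⟨Ua, e⟩`.
    have h4 : 1 - 2 * η ≤ ‖(U i.1).transpose.toEuclideanLin (x i)‖ := by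
      have h5 := real_inner_le_norm (a i) ((U i.1).transpose.toEuclideanLin (x i))
      rw [← inner_toEuclideanLin_right, ha, one_mul, hx, inner_add_right,
        real_inner_self_eq_norm_sq, norm_toEuclideanLin_of_orthonormal (hU i.1), ha,
        real_inner_comm, ← hx] at h5
      linarith [hg i]
    gcongr
  · refine lt_of_le_of_lt ?_ (separation (hA _ _ hp) hA0
      (frobenius_div_le_affinity (hd p.1) (hd i.1) (U p.1) (U i.1)) hl hη hξ (hs1 i.1)
      (hsD i.1) hcond)
    have h4 : inner ℝ (x i) (x p) =
        inner ℝ ((U p.1).toEuclideanLin (a p)) ((U i.1).toEuclideanLin (a i)) +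
        (inner ℝ (e i) ((U p.1).toEuclideanLin (a p)) +
          inner ℝ (e p) ((U i.1).toEuclideanLin (a i))) + inner ℝ (e p) (e i) := by
      rw [hx, hx]
      simp only [inner_add_left, inner_add_right]
      rw [real_inner_comm (e i) (e p), real_inner_comm ((U p.1).toEuclideanLin (a p))
        ((U i.1).toEuclideanLin (a i)), real_inner_comm ((U i.1).toEuclideanLin (a i)) (e p)]
      ring
    rw [h4]
    exact (abs_add_le _ _).trans (add_le_add ((abs_add_le _ _).trans
      (add_le_add (h1 i p hp) (h2 i p hp))) (h3 i p hp))

/-- The polynomial terms add up to `N * N⁻² + N² * 20/3 * N⁻³ = 23/3 * 1/N`, within the allowed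
`10/N`. -/
theorem sum_failure_bounds_le {L N : ℕ} {n : Fin L → ℕ} (hN0 : (0 : ℝ) < N) (hN : N = ∑ l, n l) :
    ∑ i : Σ l : Fin L, Fin (n l), (Real.exp (-(2 * Real.log N)) +
      Real.exp (-(1 / 1000) * ((n i.1 : ℝ) - 1)) +
        N * (20 / 3 * Real.exp (-(3 * Real.log N)))) ≤
      10 / N + ∑ k, (n k : ℝ) * Real.exp (-(1 / 1000) * ((n k : ℝ) - 1)) := by
  have hcardN : Fintype.card (Σ l : Fin L, Fin (n l)) = N := by
    rw [Fintype.card_sigma, hN]; simp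
  have hexpl : Real.exp (-Real.log N) = (N : ℝ)⁻¹ := by rw [Real.exp_neg, Real.exp_log hN0]
  rw [Finset.sum_add_distrib, Finset.sum_add_distrib, Finset.sum_const, Finset.sum_const,
    Finset.card_univ, hcardN, Fintype.sum_sigma]
  simp only [Finset.sum_const, Finset.card_univ, Fintype.card_fin, nsmul_eq_mul]
  have e2 : Real.exp (-(2 * Real.log N)) = (N : ℝ)⁻¹ ^ 2 := by
    rw [← hexpl, ← Real.exp_nat_mul]; congr 1; push_cast; ring
  have e3 : Real.exp (-(3 * Real.log N)) = (N : ℝ)⁻¹ ^ 3 := by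
    rw [← hexpl, ← Real.exp_nat_mul]; congr 1; push_cast; ring
  rw [e2, e3]
  have h1 : (N : ℝ) * (N : ℝ)⁻¹ ^ 2 = 1 / N := by field_simp
  have h2 : (N : ℝ) * (N * (20 / 3 * (N : ℝ)⁻¹ ^ 3)) = 20 / 3 * (1 / N) := by field_simp
  have h3 : (10 : ℝ) / N = 10 * (1 / N) := by ring
  have h4 : (0 : ℝ) ≤ 1 / N := by positivity
  rw [h1, h2, h3]
  linarith

end TSC

/-! ### The main theorem -/

theorem theorem1 :
    ∃ c : ℝ, 0 < c ∧
      ∀ (L m q : ℕ) (n d : Fin L → ℕ) (ρ : Fin L → ℝ) (σ : ℝ)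
        (U : (l : Fin L) → Matrix (Fin m) (Fin (d l)) ℝ)
        (Ω : Type*) [MeasurableSpace Ω] (μ : Measure Ω) [IsProbabilityMeasure μ]
        (a : (i : Σ l : Fin L, Fin (n l)) → Ω → EuclideanSpace ℝ (Fin (d i.1)))
        (e : (Σ l : Fin L, Fin (n l)) → Ω → EuclideanSpace ℝ (Fin m))
        (x : (Σ l : Fin L, Fin (n l)) → Ω → EuclideanSpace ℝ (Fin m))
        (N : ℕ),
        -- the number of points
        N = ∑ l, n l →
        (∀ l, (n l : ℝ) = ρ l * q) → (∀ l, 6 ≤ ρ l) →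
        -- orthonormal bases of nonzero subspaces
        (∀ l, 1 ≤ d l) → (∀ l, (U l).transpose * U l = 1) →
        -- the random model
        0 ≤ σ →
        (∀ i, HasLaw (a i) (TSC.uniformSphere (d i.1)) μ) →
        (∀ i, HasLaw (e i) (TSC.noiseLaw m σ) μ) →
        iIndepFun a μ → iIndepFun e μ →
        IndepFun (fun ω i => a i ω) (fun ω i => e i ω) μ →
        (∀ i ω, x i ω = (U i.1).toEuclideanLin (a i ω) + e i ω) →
        -- the clustering condition
        TSC.maxAffinity U + σ * (1 + σ) / Real.sqrt (Real.log N) *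
            (Real.sqrt ((Finset.univ.sup d : ℕ) : ℝ) / Real.sqrt m) ≤
          1 / (12 * Real.log N) →
        6 * Real.log N ≤ m →
        1 - 10 / (N : ℝ) - ∑ l, (n l : ℝ) * Real.exp (-c * ((n l : ℝ) - 1)) ≤
          μ.real {ω | ∀ S : (Σ l : Fin L, Fin (n l)) → Finset (Σ l : Fin L, Fin (n l)),
            (∀ j, TSC.IsNeighborSet q (fun i => x i ω) j (S j)) →
              TSC.SubspaceDetection q (fun i : Σ l : Fin L, Fin (n l) => i.1)
                (TSC.adjacency (fun i => x i ω) S)} := by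
  classical
  refine ⟨1 / 1000, by norm_num, ?_⟩
  intro L m q n d ρ σ U Ω _ μ _ a e x N hN hρ hρ6 hd hU hσ ha he hai hei hae hx hcond hm
  have hsum0 : 0 ≤ ∑ l, (n l : ℝ) * Real.exp (-(1 / 1000) * ((n l : ℝ) - 1)) :=
    Finset.sum_nonneg fun l _ => by positivity
  set good : Set Ω := {ω | ∀ S : (Σ l : Fin L, Fin (n l)) → Finset (Σ l : Fin L, Fin (n l)),
            (∀ j, TSC.IsNeighborSet q (fun i => x i ω) j (S j)) →
              TSC.SubspaceDetection q (fun i : Σ l : Fin L, Fin (n l) => i.1)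
                (TSC.adjacency (fun i => x i ω) S)}
  -- For `N = 0` the term `10 / N` is 0 by convention, so the claim is not vacuous; it holds because
  -- there are no points.
  rcases Nat.eq_zero_or_pos N with hN0 | hNpos
  · have hn : ∀ l, n l = 0 := by
      intro l
      have := hN ▸ hN0
      exact (Finset.sum_eq_zero_iff.1 this) l (Finset.mem_univ l)
    have hempty : IsEmpty (Σ l : Fin L, Fin (n l)) := ⟨fun i => by
      have h1 := i.2.2
      have h2 := hn i.1
      omega⟩
    have hgood : good = Set.univ := by
      refine Set.eq_univ_of_forall fun ω S _ => ⟨fun i => hempty.elim i, fun i => hempty.elim i⟩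
    rw [hgood, hN0]
    simp [hn]
  have hNR : (0 : ℝ) < N := by exact_mod_cast hNpos
  -- For `1 ≤ N ≤ 10` the claimed lower bound is not positive; beyond that `log N > 0`.
  by_cases hN10 : N ≤ 10
  · have h1 : (1 : ℝ) ≤ 10 / N := by
      rw [le_div_iff₀ hNR]; exact_mod_cast (by omega : 1 * N ≤ 10)
    have : 0 ≤ μ.real good := measureReal_nonneg
    linarith
  have hl : 0 < Real.log N := Real.log_pos (by exact_mod_cast (by omega : 1 < N))
  set l : ℝ := Real.log N
  have hmR : (0 : ℝ) < m := by linarith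
  have hm0 : 0 < m := by exact_mod_cast hmR
  -- From `n ≥ 6q`: the spare `q` absorbs the excluded point itself when `q ≥ 1`, and `q = 0` is
  -- trivial.
  have hq : ∀ k, 5 * q ≤ n k - 1 := by
    intro k
    have h1 : (6 * q : ℝ) ≤ n k := by
      rw [hρ k]; exact mul_le_mul_of_nonneg_right (hρ6 k) (Nat.cast_nonneg _)
    have h2 : 6 * q ≤ n k := by exact_mod_cast h1
    omega
  set η := σ * Real.sqrt (l / m)
  set ξ := σ ^ 2 * Real.sqrt (l / m)
  have hη : 0 ≤ η := by positivity
  have hξ : 0 ≤ ξ := by positivity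
  set D := Real.sqrt ((Finset.univ.sup d : ℕ) : ℝ)
  have hcond' : l * TSC.maxAffinity U + (η + ξ) * D ≤ 1 / 12 :=
    TSC.clustering_condition_mul hl hmR hcond
  have hsD : ∀ k, Real.sqrt (d k) ≤ D := fun k =>
    Real.sqrt_le_sqrt (by exact_mod_cast Finset.le_sup (Finset.mem_univ k))
  have hs1 : ∀ k, 1 ≤ Real.sqrt (d k) := fun k =>
    Real.one_le_sqrt.2 (by exact_mod_cast hd k)
  have hA0 := TSC.maxAffinity_nonneg U
  let u : (Σ l : Fin L, Fin (n l)) → Ω → EuclideanSpace ℝ (Fin m) :=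
    fun i ω => (U i.1).toEuclideanLin (a i ω)
  let A : (k : Fin L) → Set (EuclideanSpace ℝ (Fin m) × EuclideanSpace ℝ (Fin m)) := fun k =>
    {p | 5 / 12 * (‖(U k).transpose.toEuclideanLin p.1‖ / Real.sqrt (d k)) ≤ |inner ℝ p.1 p.2|}
  let J : (Σ l : Fin L, Fin (n l)) → Finset (Σ l : Fin L, Fin (n l)) := fun i =>
    Finset.univ.filter fun j => j ≠ i ∧ j.1 = i.1
  let P : (Σ l : Fin L, Fin (n l)) → (Σ l : Fin L, Fin (n l)) → Ω → Prop := fun i p ω =>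
    p.1 ≠ i.1 →
      (|inner ℝ (u p ω) (u i ω)| ≤ 24 / 5 * l * (TSC.frobenius ((U p.1).transpose * U i.1) /
          (Real.sqrt (d p.1) * Real.sqrt (d i.1))) ∧
        |inner ℝ (e i ω) (u p ω) + inner ℝ (e p ω) (u i ω)| ≤ 4 * η) ∧
        |inner ℝ (e p ω) (e i ω)| ≤ 24 / 5 * ξ
  let Q : (Σ l : Fin L, Fin (n l)) → Ω → Prop := fun i ω =>
    ((‖a i ω‖ = 1 ∧ -(2 * η) ≤ inner ℝ (e i ω) (u i ω)) ∧
      q ≤ ((J i).filter fun j => (x i ω, x j ω) ∈ A i.1).card) ∧ ∀ p, P i p ω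
  -- the deterministic part
  have hdet : ∀ ω, (∀ i, Q i ω) → ω ∈ good := by
    intro ω hω S hS
    exact TSC.subspaceDetection_of_bounds hd hU hA0 (fun _ _ => TSC.affinity_le_maxAffinity U)
      hl hη hξ hs1 hsD hcond' (fun i => hx i ω) (fun i => (hω i).1.1.1) (fun i => (hω i).1.1.2)
      (fun i => ⟨_, (hω i).1.2, fun j hj =>
        ⟨(Finset.mem_filter.1 (Finset.mem_filter.1 hj).1).2.1, (Finset.mem_filter.1 hj).2⟩⟩)
      (fun i p hp => ((hω i).2 p hp).1.1) (fun i p hp => ((hω i).2 p hp).1.2)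
      (fun i p hp => ((hω i).2 p hp).2) hS
  -- the probabilistic part
  have ham := fun i => (ha i).aemeasurable
  have hem := fun i => (he i).aemeasurable
  have hum : ∀ i, AEMeasurable (u i) μ := fun i =>
    (TSC.measurable_toEuclideanLin (U i.1)).comp_aemeasurable (ham i)
  have ha1 : ∀ i, ∀ᵐ ω ∂μ, ‖a i ω‖ = 1 := fun i => by
    have h := TSC.norm_eq_one_ae_uniformSphere (d i.1)
    rw [← (ha i).map_eq] at h
    exact ae_of_ae_map (ham i) h
  have hu1 : ∀ i, ∀ᵐ ω ∂μ, ‖u i ω‖ = 1 := fun i => by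
    filter_upwards [ha1 i] with ω hω
    rw [TSC.norm_toEuclideanLin_of_orthonormal (hU i.1), hω]
  have hui : iIndepFun u μ :=
    hai.comp (fun i => (U i.1).toEuclideanLin) fun i => TSC.measurable_toEuclideanLin _
  have hue : IndepFun (fun ω i => u i ω) (fun ω i => e i ω) μ :=
    TSC.indepFun_pi_comp_left (a := a) (T := fun i => (U i.1).toEuclideanLin) hae fun i => TSC.measurable_toEuclideanLin (U i.1)
  have hxi : iIndepFun x μ := by
    have h := (TSC.iIndepFun_prodMk_of_indepFun hum hem hui hei hue).comp
      (fun _ p => p.1 + p.2) fun _ => measurable_fst.add measurable_snd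
    have hxu : x = fun i => (fun p : EuclideanSpace ℝ (Fin m) × EuclideanSpace ℝ (Fin m) =>
        p.1 + p.2) ∘ fun ω => (u i ω, e i ω) := funext fun i => funext (hx i)
    rw [hxu]
    exact h
  have hxeq : ∀ i, x i = fun ω => (U i.1).toEuclideanLin (a i ω) + e i ω := fun i => funext (hx i)
  have hxm : ∀ i, AEMeasurable (x i) μ := fun i => by
    rw [hxeq i]; exact (hum i).add (hem i)
  have hAm : ∀ k, MeasurableSet (A k) := fun k => by
    have := TSC.measurable_toEuclideanLin (U k).transpose
    exact measurableSet_le (by fun_prop) (by fun_prop)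
  have hcount : ∀ i, μ {ω | ¬ q ≤ ((J i).filter fun j => (x i ω, x j ω) ∈ A i.1).card} ≤
      ENNReal.ofReal (Real.exp (-(1 / 1000) * ((n i.1 : ℝ) - 1))) := by
    intro i
    have hcard : (J i).card = n i.1 - 1 := TSC.card_same_label n i
    have hn1 : 1 ≤ n i.1 := by have := i.2.2; omega
    have h := TSC.measure_card_filter_lt_le hxm hxi (i := i) (J := J i) (by simp [J])
      (hAm i.1) (q := q) ?_ (by rw [hcard]; exact hq i.1)
    · rw [hcard, Nat.cast_sub hn1, Nat.cast_one, ← neg_mul] at h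
      simp_rw [not_le]
      convert! h
    · intro y j hj
      have hj1 : j.1 = i.1 := (Finset.mem_filter.1 hj).2.2
      rw [hxeq j]
      have h := TSC.map_signal_add_noise_small_ball (hd j.1) (U j.1) (ha j) (he j)
        (hae.comp (measurable_pi_apply j) (measurable_pi_apply j)) y
      rw [← hj1]
      exact h
  have hP : ∀ i p, μ {ω | ¬ P i p ω} ≤ ENNReal.ofReal (20 / 3 * Real.exp (-(3 * l))) := by
    intro i p
    by_cases hip : p.1 ≠ i.1
    swap
    · simp [P, hip]
    have hpi : p ≠ i := fun h => hip (h ▸ rfl)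
    simp only [P, hip, true_imp_iff, ne_eq, not_false_eq_true]
    -- The level `24/5 * l` is chosen so that `5/8 * 24/5 = 3`, giving `N⁻³` for each of the at most
    -- `N²` pairs.
    have h1 := TSC.measure_inner_signals_le (hd p.1) (hd i.1) (U p.1) (U i.1) (ha p) (ha i)
      (hai.indepFun hpi) (24 / 5 * l)
    have h2 := TSC.measure_inner_mixed_le hm0 hσ hl (hum p) (hum i) (hu1 p) (hu1 i) (he i) (he p)
      (hei.indepFun hpi.symm)
      (hue.comp (φ := fun v => (v p, v i)) (ψ := fun v => (v i, v p))
        ((measurable_pi_apply p).prodMk (measurable_pi_apply i))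
        ((measurable_pi_apply i).prodMk (measurable_pi_apply p)))
    have h3 := TSC.measure_inner_noises_le hm0 hσ hl hm (he p) (he i) (hei.indepFun hpi)
    refine (TSC.measure_not_and_le _ _).trans
      ((add_le_add_left (TSC.measure_not_and_le _ _) _).trans ?_)
    simp only [not_le]
    refine (add_le_add (add_le_add h1 h2) h3).trans ?_
    rw [← ENNReal.ofReal_add (by positivity) (by positivity),
      ← ENNReal.ofReal_add (by positivity) (by positivity)]
    refine ENNReal.ofReal_le_ofReal ?_
    -- The three prefactors add up to `8/3 + 2 + 2 = 20/3`.
    have h4 : Real.exp (-(4 * l)) ≤ Real.exp (-(3 * l)) := Real.exp_le_exp.2 (by linarith)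
    have h5 : -(5 / 8 * (24 / 5 * l)) = -(3 * l) := by ring
    rw [h5]
    linarith
  have hcardN : Fintype.card (Σ l : Fin L, Fin (n l)) = N := by
    rw [Fintype.card_sigma, hN]; simp
  have hQ : ∀ i, μ {ω | ¬ Q i ω} ≤ ENNReal.ofReal (Real.exp (-(2 * l)) +
      Real.exp (-(1 / 1000) * ((n i.1 : ℝ) - 1)) + N * (20 / 3 * Real.exp (-(3 * l)))) := by
    intro i
    have h0 : μ {ω | ¬ ‖a i ω‖ = 1} = 0 := ha1 i
    have h1 := TSC.measure_inner_signal_noise_le hm0 hσ hl (hum i) (hu1 i) (he i)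
      (hue.comp (measurable_pi_apply i) (measurable_pi_apply i))
    simp_rw [← not_le] at h1
    have h2 : μ {ω | ¬ ∀ p, P i p ω} ≤
        ENNReal.ofReal (N * (20 / 3 * Real.exp (-(3 * l)))) := by
      refine (TSC.measure_not_forall_le (P i)).trans ((Finset.sum_le_sum fun p _ => hP i p).trans ?_)
      rw [Finset.sum_const, Finset.card_univ, hcardN, nsmul_eq_mul,
        ENNReal.ofReal_mul (Nat.cast_nonneg N), ENNReal.ofReal_natCast]
    rw [ENNReal.ofReal_add (by positivity) (by positivity),
      ENNReal.ofReal_add (by positivity) (by positivity)]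
    refine (TSC.measure_not_and_le _ _).trans (add_le_add ?_ h2)
    refine (TSC.measure_not_and_le _ _).trans (add_le_add ?_ (hcount i))
    refine (TSC.measure_not_and_le _ _).trans ?_
    rw [h0, zero_add]
    exact h1
  have hbad : μ goodᶜ ≤ ENNReal.ofReal (10 / N +
      ∑ k, (n k : ℝ) * Real.exp (-(1 / 1000) * ((n k : ℝ) - 1))) := by
    refine (TSC.measure_compl_le_sum hdet hQ).trans ?_
    rw [← ENNReal.ofReal_sum_of_nonneg fun i _ => by positivity]
    exact ENNReal.ofReal_le_ofReal (TSC.sum_failure_bounds_le hNR hN)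
  have h := TSC.one_sub_le_measureReal (by positivity) hbad
  linarith
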